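/- Fix $m\ge 1$, let $\mu_m\subset\mathbb C^*$ be the group of $m$-th roots of unity and $\zeta_m=e^{2\pi i/m}$. Let $\Lambda$ be the ring of symmetric functions over $\mathbb C$, with power sums $p_n$ ($p_\lambda=\prod_i p_{\lambda_i}$), complete homogeneous functions $h_n$ and Schur functions $s_\lambda$. For a formal power series $A=\sum_\alpha c_\alpha t^\alpha$ over $\mathbb C$, plethystic substitution $F\mapsto F(A)$ is the $\mathbb C$-algebra homomorphism from $\Lambda$ to power series with $p_n\mapsto p_n(A):=\sum_\alpha c_\alpha t^{n\alpha}$ for all $n\ge1$ (coefficients are not raised to powers). Put $\Omega(A)=\sum_{n\ge0}h_n(A)$ and, for $Y=y_1+y_2+\cdots$ and $\zeta\in\mathbb C$, $\Omega(Y;\zeta)=\prod_{i\ge1}(1-\zeta y_i)^{-1}$. For $\zeta\in\mu_m$ let $X_\zeta=x_{\zeta,1}+x_{\zeta,2}+\cdots$, and let $R=\bigotimes_{\zeta\in\mu_m}\Lambda(X_\zeta)$. For a function $\rho$ from $\mu_m$ to the set of integer partitions put $$P_\rho=\prod_{\zeta\in\mu_m}p_{\rho(\zeta)}(X_\zeta),\qquad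 Z_\rho=\prod_{\zeta\in\mu_m}z_{\rho(\zeta)}m^{\ell(\rho(\zeta))},\qquad S_\rho=\prod_{1\le j\le m}s_{\rho(\zeta_m^j)}\Big(\frac1m\sum_{\zeta\in\mu_m}\zeta^jX_\zeta\Big),$$ where $z_\lambda=\prod_{r\ge1}m_r(\lambda)!\,r^{m_r(\lambda)}$, $m_r(\lambda)$ is the number of parts of $\lambda$ equal to $r$, and $\ell(\lambda)$ is the number of parts. The $P_\rho$ form a basis of $R$. Let $(-,-)$ be the $\mathbb C$-bilinear pairing on $R$ with $(P_\rho,P_\gamma)=\delta_{\rho,\gamma}Z_\rho$, and put $\overline{\sum_\rho a_\rho P_\rho}=\sum_\rho\overline{a_\rho}P_\rho$. The pairing is extended in its first argument to power series in $Y$ whose coefficients are (possibly infinite) sums of homogeneous elements of $R$ of distinct degrees: the pairing is taken coefficientwise in $Y$ and degree by degree in the variables $x_{\zeta,i}$. Then for every function $\rho$ from $\mu_m$ to the set of partitions, the series $$G_\rho(Y):=\Big(\Omega\Big(\frac1m\sum_{\zeta\in\mu_m}X_\zeta\,\Omega(Y;\zeta)\Big),\ \overline{S_\rho}\Big)$$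 satisfies $$G_\rho(Y)=\prod_{0\le j\le m-1}s_{\rho(\zeta_m^j)}\Big(\sum_{k\ge0}h_{km+j}(Y)\Big).$$ -/

import Mathlib

namespace WreathSym

noncomputable section

open scoped Classical ComplexOrder

/-- The power sum `∑ x_v ^ n` over all variables `v` of colour `i`. -/
def colourPowerSum {σ ι : Type*} (c : σ → ι) (i : ι) (n : ℕ) : MvPowerSeries σ ℂ :=
  fun α => if ∃ v, c v = i ∧ α = Finsupp.single v n then 1 else 0

/-- Products of the `colourPowerSum`s. -/
def colourPowerProd {σ ι : Type*} (c : σ → ι) (s : Multiset (ι × ℕ+)) : MvPowerSeries σ ℂ :=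
  (s.map fun x => colourPowerSum c x.1 x.2).prod

/-- The coloured multiset of nonzero exponents of a monomial. -/
def colourType {σ ι : Type*} (c : σ → ι) (α : σ →₀ ℕ) : Multiset (ι × ℕ+) :=
  α.support.val.map fun v => (c v, (α v).toPNat')

section aux
variable {σ ι : Type*} (c : σ → ι)

lemma coeff_colourPowerSum (i : ι) (n : ℕ) (α : σ →₀ ℕ) :
    MvPowerSeries.coeff α (colourPowerSum c i n) =
      if ∃ v, c v = i ∧ α = Finsupp.single v n then 1 else 0 := rfl

lemma colourType_single_add (v : σ) (n : ℕ+) (β : σ →₀ ℕ) (h : β v = 0) :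
    colourType c (Finsupp.single v (n : ℕ) + β) = (c v, n) ::ₘ colourType c β := by
  have hv : v ∉ β.support := by simpa using h
  have hs : (Finsupp.single v (n : ℕ) + β).support = insert v β.support := by
    ext w
    by_cases hw : w = v
    · subst hw; simp
    · simp [hw]
  unfold colourType
  rw [hs, Finset.insert_val_of_notMem hv, Multiset.map_cons]
  congr 1
  · simp [h]
  · apply Multiset.map_congr rfl
    intro w hw
    have : w ≠ v := by rintro rfl; exact hv hw
    simp [Ne.symm this]

lemma card_colourType (α : σ →₀ ℕ) : (colourType c α).card = α.support.card := by
  simp [colourType]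

lemma colourPowerProd_cons (x : ι × ℕ+) (s : Multiset (ι × ℕ+)) :
    colourPowerProd c (x ::ₘ s) = colourPowerSum c x.1 x.2 * colourPowerProd c s := by
  simp [colourPowerProd]

lemma coeff_colourPowerProd_nonneg (s : Multiset (ι × ℕ+)) (α : σ →₀ ℕ) :
    0 ≤ MvPowerSeries.coeff α (colourPowerProd c s) := by
  induction s using Multiset.induction_on generalizing α with
  | empty =>
    rw [colourPowerProd, Multiset.map_zero, Multiset.prod_zero, MvPowerSeries.coeff_one]
    split_ifs <;> simp
  | cons x s ih =>
    rw [colourPowerProd_cons, MvPowerSeries.coeff_mul]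
    refine Finset.sum_nonneg fun y _ => mul_nonneg ?_ (ih _)
    rw [coeff_colourPowerSum]
    split_ifs <;> simp

lemma colourType_of_coeff_ne_zero (s : Multiset (ι × ℕ+)) (α : σ →₀ ℕ)
    (h : MvPowerSeries.coeff α (colourPowerProd c s) ≠ 0) :
    α.support.card ≤ s.card ∧ (α.support.card = s.card → colourType c α = s) := by
  induction s using Multiset.induction_on generalizing α with
  | empty =>
    rw [colourPowerProd, Multiset.map_zero, Multiset.prod_zero, MvPowerSeries.coeff_one] at h
    have : α = 0 := by by_contra h'; simp [h'] at h
    subst this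
    simp [colourType]
  | cons x s ih =>
    rw [colourPowerProd_cons, MvPowerSeries.coeff_mul] at h
    obtain ⟨⟨a, β⟩, hy, hne⟩ := Finset.exists_ne_zero_of_sum_ne_zero h
    rw [Finset.HasAntidiagonal.mem_antidiagonal] at hy
    dsimp only at hy hne
    have hβ := ih β (right_ne_zero_of_mul hne)
    have ha := left_ne_zero_of_mul hne
    rw [coeff_colourPowerSum] at ha
    obtain ⟨v, hv, rfl⟩ : ∃ v, c v = x.1 ∧ a = Finsupp.single v (x.2 : ℕ) := by
      by_contra h'; simp [h'] at ha
    subst hy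
    have hx : x = (c v, x.2) := by rw [hv]
    by_cases hz : β v = 0
    · have ht := colourType_single_add c v x.2 β hz
      have hc := congrArg Multiset.card ht
      rw [card_colourType, Multiset.card_cons, card_colourType] at hc
      rw [ht, hc, Multiset.card_cons, ← hx]
      refine ⟨by omega, fun h => by rw [hβ.2 (by omega)]⟩
    · have hsub : (Finsupp.single v (x.2 : ℕ) + β).support ⊆ β.support := by
        intro w hw
        by_cases hw' : w = v
        · subst hw'; simpa using hz
        · simpa [Finsupp.single_apply, Ne.symm hw'] using hw
      have := Finset.card_le_card hsub
      rw [Multiset.card_cons]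
      refine ⟨by omega, fun h => by omega⟩

lemma coeff_colourType_ne_zero (α : σ →₀ ℕ) :
    MvPowerSeries.coeff α (colourPowerProd c (colourType c α)) ≠ 0 := by
  induction α using Finsupp.induction with
  | zero => simp [colourType, colourPowerProd]
  | single_add v n β hv hn ih =>
    lift n to ℕ+ using Nat.pos_of_ne_zero hn
    rw [colourType_single_add c v n β (by simpa using hv), colourPowerProd_cons,
      MvPowerSeries.coeff_mul]
    refine (lt_of_lt_of_le (lt_of_le_of_ne (coeff_colourPowerProd_nonneg c _ β) ih.symm) ?_).ne'
    refine le_trans ?_ (Finset.single_le_sum (a := (Finsupp.single v (n : ℕ), β)) ?_ (by simp))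
    · dsimp only
      rw [coeff_colourPowerSum, if_pos ⟨v, rfl, rfl⟩, one_mul]
    · intro y _
      refine mul_nonneg ?_ (coeff_colourPowerProd_nonneg c _ _)
      rw [coeff_colourPowerSum]
      split_ifs <;> simp

lemma exists_colourType (hc : ∀ i, (c ⁻¹' {i}).Infinite) (s : Multiset (ι × ℕ+)) :
    ∃ α, colourType c α = s := by
  induction s using Multiset.induction_on with
  | empty => exact ⟨0, by simp [colourType]⟩
  | cons x s ih =>
    obtain ⟨β, hβ⟩ := ih
    obtain ⟨v, hv, hv'⟩ := (hc x.1).exists_notMem_finset β.support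
    refine ⟨Finsupp.single v (x.2 : ℕ) + β, ?_⟩
    rw [colourType_single_add c v x.2 β (by simpa using hv'), hβ, hv]

lemma coeff_colourPowerProd_eq_zero (s : Multiset (ι × ℕ+)) (α : σ →₀ ℕ)
    (h : s.card ≤ α.support.card) (h' : colourType c α ≠ s) :
    MvPowerSeries.coeff α (colourPowerProd c s) = 0 := by
  by_contra hne
  have := colourType_of_coeff_ne_zero c s α hne
  exact h' (this.2 (by omega))

lemma linearIndependent_colourPowerProd (hc : ∀ i, (c ⁻¹' {i}).Infinite) :
    LinearIndependent ℂ (colourPowerProd c) := by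
  rw [linearIndependent_iff']
  intro S g hg
  by_contra! hcon
  obtain ⟨t, htS, ht⟩ := hcon
  obtain ⟨s, hs, hmax⟩ := Finset.exists_max_image (S.filter fun s => g s ≠ 0) Multiset.card
    ⟨t, by simp [htS, ht]⟩
  rw [Finset.mem_filter] at hs
  obtain ⟨α, hα⟩ := exists_colourType c hc s
  have h := congrArg (MvPowerSeries.coeff α) hg
  rw [map_sum, map_zero, Finset.sum_eq_single s] at h
  · rw [map_smul, smul_eq_mul, ← hα] at h
    rcases mul_eq_zero.1 h with h | h
    · exact hs.2 (hα ▸ h)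
    · exact coeff_colourType_ne_zero c α h
  · intro u hu hus
    rw [map_smul, smul_eq_mul]
    by_cases hgu : g u = 0
    · rw [hgu, zero_mul]
    · rw [coeff_colourPowerProd_eq_zero, mul_zero]
      · rw [← card_colourType c, hα]
        exact hmax u (by simp [hu, hgu])
      · rw [hα]; exact hus.symm
  · intro h; exact absurd hs.1 h

lemma aeval_monomial_colourPowerSum (d : ι × ℕ+ →₀ ℕ) :
    MvPolynomial.aeval (fun x : ι × ℕ+ => colourPowerSum c x.1 x.2)
      (MvPolynomial.monomial d (1 : ℂ)) = colourPowerProd c (Finsupp.toMultiset d) := by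
  rw [MvPolynomial.aeval_monomial, map_one, one_mul, colourPowerProd,
    Finsupp.toMultiset_map, Finsupp.prod_toMultiset, Finsupp.prod_mapDomain_index (by simp)
      (fun _ _ _ => pow_add _ _ _)]

lemma exists_perm_of_colourType_eq (α β : ℕ →₀ ℕ)
    (h : colourType (fun _ : ℕ => ()) α = colourType (fun _ : ℕ => ()) β) :
    ∃ e : Equiv.Perm ℕ, Finsupp.mapDomain e α = β := by
  induction α using Finsupp.induction generalizing β with
  | zero =>
    refine ⟨1, ?_⟩
    have := congrArg Multiset.card h
    rw [card_colourType, card_colourType] at this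
    rw [Finsupp.support_zero, Finset.card_empty, eq_comm, Finset.card_eq_zero,
      Finsupp.support_eq_empty] at this
    simp [this]
  | single_add v n α hv hn ih =>
    lift n to ℕ+ using Nat.pos_of_ne_zero hn
    rw [colourType_single_add _ v n α (by simpa using hv)] at h
    have hmem : ((), n) ∈ colourType (fun _ : ℕ => ()) β := h ▸ Multiset.mem_cons_self _ _
    obtain ⟨w, hw, hwn⟩ := Multiset.mem_map.1 hmem
    have hwn' : β w = n := by
      have h1 : (β w).toPNat' = n := (Prod.ext_iff.1 hwn).2
      have h2 : β w ≠ 0 := by simpa using hw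
      rw [← h1, Nat.toPNat'_coe, if_pos (Nat.pos_of_ne_zero h2)]
    have hβ : Finsupp.single w (n : ℕ) + β.erase w = β := by
      rw [← hwn']; exact Finsupp.single_add_erase w β
    rw [← hβ, colourType_single_add _ w n _ (by simp), Multiset.cons_inj_right] at h
    obtain ⟨e, he⟩ := ih _ h
    refine ⟨e.trans (Equiv.swap (e v) w), ?_⟩
    rw [Finsupp.mapDomain_add, ← hβ, Finsupp.mapDomain_single]
    congr 1
    · simp
    · rw [← he]
      refine Finsupp.mapDomain_congr fun u hu => ?_
      have h1 : e u ≠ e v := fun h => by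
        have := e.injective h
        subst this; exact hv hu
      have h2 : e u ≠ w := fun h => by
        have h3 : (Finsupp.mapDomain e α) (e u) = α u := Finsupp.mapDomain_apply e.injective _ _
        rw [he, h, Finsupp.erase_same] at h3
        exact (Finsupp.mem_support_iff.1 hu) h3.symm
      simp [Equiv.swap_apply_of_ne_of_ne h1 h2]

end aux

/-! ### Symmetric functions -/

/-- A partition: a finite multiset of positive integers. -/
abbrev Par : Type := Multiset ℕ+

/-- `z_λ = ∏_r m_r(λ)! r ^ m_r(λ)`. -/
def zPar (lam : Par) : ℕ :=
  ∏ r ∈ lam.toFinset, (lam.count r).factorial * (r : ℕ) ^ lam.count r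

/-- The ring `Λ` of symmetric functions over `ℂ` in the variables `x_0, x_1, …`: the power series
of bounded degree that are invariant under all permutations of the variables. -/
def Lam : Subalgebra ℂ (MvPowerSeries ℕ ℂ) where
  carrier := {f | (∀ e : Equiv.Perm ℕ, MvPowerSeries.rename e f = f) ∧
    ∃ d : ℕ, ∀ α : ℕ →₀ ℕ, d < α.degree → MvPowerSeries.coeff α f = 0}
  mul_mem' := by
    rintro f g ⟨hf, df, hdf⟩ ⟨hg, dg, hdg⟩
    refine ⟨fun e => by rw [map_mul, hf, hg], df + dg, fun α hα => ?_⟩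
    rw [MvPowerSeries.coeff_mul]
    refine Finset.sum_eq_zero fun x hx => ?_
    rw [Finset.HasAntidiagonal.mem_antidiagonal] at hx
    have h : x.1.degree + x.2.degree = α.degree := by rw [← hx, map_add]
    by_cases h1 : df < x.1.degree
    · rw [hdf _ h1, zero_mul]
    · rw [hdg _ (by omega), mul_zero]
  add_mem' := by
    rintro f g ⟨hf, df, hdf⟩ ⟨hg, dg, hdg⟩
    refine ⟨fun e => by rw [map_add, hf, hg], df + dg, fun α hα => ?_⟩
    rw [map_add, hdf _ (by omega), hdg _ (by omega), add_zero]
  algebraMap_mem' r := by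
    refine ⟨fun e => AlgHom.commutes _ r, 0, fun α hα => ?_⟩
    have : α ≠ 0 := by rintro rfl; simp at hα
    rw [MvPowerSeries.algebraMap_apply, Algebra.algebraMap_self, RingHom.id_apply,
      MvPowerSeries.coeff_C, if_neg this]

lemma coeff_mapDomain_rename (e : Equiv.Perm ℕ) (f : MvPowerSeries ℕ ℂ) (α : ℕ →₀ ℕ) :
    MvPowerSeries.coeff (Finsupp.mapDomain e α) (MvPowerSeries.rename e f) =
      MvPowerSeries.coeff α f := by
  have := MvPowerSeries.coeff_embDomain_rename e.toEmbedding f α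
  rw [Finsupp.embDomain_eq_mapDomain] at this
  exact this

/-- Invariance under permutations of the variables, on the level of coefficients. -/
lemma mem_Lam_of_coeff (f : MvPowerSeries ℕ ℂ)
    (h : ∀ (e : Equiv.Perm ℕ) (α : ℕ →₀ ℕ),
      MvPowerSeries.coeff (Finsupp.mapDomain e α) f = MvPowerSeries.coeff α f)
    (hd : ∃ d : ℕ, ∀ α : ℕ →₀ ℕ, d < α.degree → MvPowerSeries.coeff α f = 0) : f ∈ Lam := by
  refine ⟨fun e => ?_, hd⟩
  ext β
  obtain ⟨α, rfl⟩ : ∃ α, Finsupp.mapDomain e α = β :=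
    ⟨Finsupp.mapDomain e.symm β, by rw [← Finsupp.mapDomain_comp]; simp⟩
  rw [coeff_mapDomain_rename, h]

/-- The complete homogeneous series `h_n`, the sum of all monomials of degree `n`. -/
def hSeries (n : ℕ) : MvPowerSeries ℕ ℂ := fun α => if α.degree = n then 1 else 0

/-- The power sum series `p_n = ∑_i x_i ^ n`. -/
def pSeries (n : ℕ+) : MvPowerSeries ℕ ℂ :=
  fun α => if ∃ i, α = Finsupp.single i (n : ℕ) then 1 else 0

lemma degree_mapDomain_perm (e : Equiv.Perm ℕ) (α : ℕ →₀ ℕ) :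
    (Finsupp.mapDomain e α).degree = α.degree := by
  simp [Finsupp.degree_mapDomain]

lemma hSeries_mem (n : ℕ) : hSeries n ∈ Lam := by
  refine mem_Lam_of_coeff _ (fun e α => ?_) ⟨n, fun α hα => if_neg (by omega)⟩
  change (if (Finsupp.mapDomain e α).degree = n then (1 : ℂ) else 0) = if α.degree = n then 1 else 0
  rw [degree_mapDomain_perm]

lemma pSeries_mem (n : ℕ+) : pSeries n ∈ Lam := by
  refine mem_Lam_of_coeff _ (fun e α => ?_) ⟨n, fun α hα => if_neg ?_⟩
  · change (if ∃ i, Finsupp.mapDomain e α = Finsupp.single i (n : ℕ) then (1 : ℂ) else 0) =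
      if ∃ i, α = Finsupp.single i (n : ℕ) then 1 else 0
    refine if_congr ⟨?_, ?_⟩ rfl rfl
    · rintro ⟨i, hi⟩
      refine ⟨e.symm i, Finsupp.mapDomain_injective e.injective ?_⟩
      rw [hi, Finsupp.mapDomain_single, Equiv.apply_symm_apply]
    · rintro ⟨i, rfl⟩
      exact ⟨e i, Finsupp.mapDomain_single⟩
  · rintro ⟨i, rfl⟩
    simp at hα

/-- `h_n` as an element of `Λ`. -/
def h (n : ℕ) : Lam := ⟨hSeries n, hSeries_mem n⟩

/-- `p_n` as an element of `Λ`, for `n ≥ 1`. -/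
def p (n : ℕ+) : Lam := ⟨pSeries n, pSeries_mem n⟩

/-- `p_λ = ∏ p_{λ_i}`. -/
def pPar (lam : Par) : Lam := (lam.map p).prod

/-- `h_k` for an integer `k`, with `h_k = 0` for `k < 0`. -/
def hInt : ℤ → Lam
  | Int.ofNat n => h n
  | Int.negSucc _ => 0

/-- The parts of a partition in weakly decreasing order. -/
def parts (lam : Par) : List ℕ+ := lam.sort (· ≥ ·)

/-- The Schur function `s_λ = det (h_{λ_i - i + j})_{1 ≤ i, j ≤ ℓ(λ)}`. -/
def schur (lam : Par) : Lam :=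
  Matrix.det (Matrix.of fun i j : Fin (parts lam).length =>
    hInt ((((parts lam).get i : ℕ+) : ℕ) - (i : ℕ) + (j : ℕ) : ℤ))

lemma colourPowerSum_unit (x : Unit × ℕ+) :
    colourPowerSum (fun _ : ℕ => ()) x.1 x.2 = pSeries x.2 := by
  funext α
  simp [colourPowerSum, pSeries]

lemma mem_adjoin_pSeries (r : ℕ) (f : MvPowerSeries ℕ ℂ) (hf : f ∈ Lam)
    (hr : ∀ α : ℕ →₀ ℕ, r ≤ α.support.card → MvPowerSeries.coeff α f = 0) :
    f ∈ Algebra.adjoin ℂ (Set.range pSeries) := by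
  induction r generalizing f with
  | zero =>
    have : f = 0 := by ext α; simp [hr α (Nat.zero_le _)]
    rw [this]; exact zero_mem _
  | succ r ih =>
    let c : ℕ → Unit := fun _ => ()
    have hmem : ∀ s, colourPowerProd c s ∈ Algebra.adjoin ℂ (Set.range pSeries) := by
      intro s
      refine Subalgebra.multiset_prod_mem _ fun y hy => ?_
      obtain ⟨x, -, rfl⟩ := Multiset.mem_map.1 hy
      exact Algebra.subset_adjoin ⟨x.2, (colourPowerSum_unit x).symm⟩
    have hle : Algebra.adjoin ℂ (Set.range pSeries) ≤ Lam :=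
      Algebra.adjoin_le (by rintro _ ⟨n, rfl⟩; exact pSeries_mem n)
    choose a ha using exists_colourType c fun i => by
      have : c ⁻¹' {i} = Set.univ := by ext; simp
      rw [this]; exact Set.infinite_univ
    have hcoeff : ∀ g ∈ Lam, ∀ α, MvPowerSeries.coeff α g =
        MvPowerSeries.coeff (a (colourType c α)) g := by
      intro g hg α
      obtain ⟨e, he⟩ := exists_perm_of_colourType_eq _ _ (ha (colourType c α)).symm
      rw [← he]
      conv_rhs => rw [← hg.1 e]
      rw [coeff_mapDomain_rename]
    obtain ⟨d, hd⟩ := hf.2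
    have hfin : {s : Multiset (Unit × ℕ+) | s.card = r ∧
        MvPowerSeries.coeff (a s) f ≠ 0}.Finite := by
      let T : Finset (Unit × ℕ+) := Finset.univ ×ˢ Finset.Icc 1 d.succPNat
      refine (Set.finite_Iic (r • T.val)).subset ?_
      rintro s ⟨hs, hne⟩
      refine Multiset.le_iff_count.2 fun x => ?_
      by_cases hx : x ∈ s
      · have hxT : x ∈ T := by
          have hx' := hx
          rw [← ha s] at hx'
          obtain ⟨v, hv, rfl⟩ := Multiset.mem_map.1 hx'
          have h1 : (a s).degree ≤ d := by
            by_contra hlt; exact hne (hd _ (by omega))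
          have h2 : a s v ≤ (a s).degree := Finsupp.le_degree v (a s)
          have h3 : a s v ≠ 0 := Finsupp.mem_support_iff.1 hv
          simp only [T, Finset.mem_product, Finset.mem_univ, true_and, Finset.mem_Icc,
            one_le]
          rw [← PNat.coe_le_coe, Nat.toPNat'_coe, if_pos (Nat.pos_of_ne_zero h3),
            Nat.succPNat_coe]
          omega
        rw [Multiset.count_nsmul, Multiset.count_eq_one_of_mem T.nodup hxT, mul_one, ← hs]
        exact Multiset.count_le_card x s
      · rw [Multiset.count_eq_zero_of_notMem hx]; exact Nat.zero_le _
    let g := ∑ s ∈ hfin.toFinset, (MvPowerSeries.coeff (a s) f /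
      MvPowerSeries.coeff (a s) (colourPowerProd c s)) • colourPowerProd c s
    have hg : g ∈ Algebra.adjoin ℂ (Set.range pSeries) :=
      Subalgebra.sum_mem _ fun s _ => Subalgebra.smul_mem _ (hmem s) _
    have hfg : f - g ∈ Lam := sub_mem hf (hle hg)
    have key : f - g ∈ Algebra.adjoin ℂ (Set.range pSeries) := by
      refine ih _ hfg fun α hα => ?_
      rw [hcoeff _ hfg]
      set t := colourType c α with ht
      have hcard : (a t).support.card = α.support.card := by
        rw [← card_colourType c, ha, ht, card_colourType]
      rw [map_sub, sub_eq_zero]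
      simp only [g, map_sum, map_smul, smul_eq_mul]
      have hz : ∀ s ∈ hfin.toFinset, s ≠ t → MvPowerSeries.coeff (a s) f /
          MvPowerSeries.coeff (a s) (colourPowerProd c s) *
          MvPowerSeries.coeff (a t) (colourPowerProd c s) = 0 := by
        intro s hs hst
        have hs' := (hfin.mem_toFinset.1 hs).1
        rw [coeff_colourPowerProd_eq_zero c s (a t) (by omega) (by rw [ha]; exact hst.symm),
          mul_zero]
      by_cases htm : t ∈ hfin.toFinset
      · rw [Finset.sum_eq_single_of_mem t htm hz, div_mul_cancel₀]
        have := coeff_colourType_ne_zero c (a t)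
        rwa [ha] at this
      · rw [Finset.sum_eq_zero fun s hs => hz s hs (by rintro rfl; exact htm hs)]
        by_contra hne
        rcases hα.eq_or_lt with h1 | h1
        · refine htm (hfin.mem_toFinset.2 ⟨?_, hne⟩)
          rw [ht, card_colourType, h1]
        · exact hne (hr _ (by omega))
    simpa using add_mem key hg

lemma pSeries_eq_colourPowerSum (n : ℕ+) :
    pSeries n = colourPowerSum (fun _ : ℕ => ()) () n := (colourPowerSum_unit ((), n)).symm

lemma aeval_p_injective : Function.Injective (MvPolynomial.aeval (R := ℂ) pSeries) := by
  have hli := linearIndependent_colourPowerProd (fun _ : ℕ => ()) (fun i => by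
    have : (fun _ : ℕ => ()) ⁻¹' {i} = Set.univ := by ext; simp
    rw [this]; exact Set.infinite_univ)
  have hli' : LinearIndependent ℂ fun d : ℕ+ →₀ ℕ =>
      colourPowerProd (fun _ : ℕ => ()) ((Finsupp.toMultiset d).map fun n => ((), n)) := by
    refine hli.comp _ fun d d' hd => ?_
    exact Multiset.toFinsupp.symm.injective
      (Multiset.map_injective (fun x y hxy => (Prod.ext_iff.1 hxy).2) hd)
  have hmon : ∀ d : ℕ+ →₀ ℕ, (MvPolynomial.aeval (R := ℂ) pSeries).toLinearMap
      (MvPolynomial.basisMonomials ℕ+ ℂ d) =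
      colourPowerProd (fun _ : ℕ => ()) ((Finsupp.toMultiset d).map fun n => ((), n)) := by
    intro d
    rw [AlgHom.toLinearMap_apply, MvPolynomial.coe_basisMonomials, MvPolynomial.aeval_monomial,
      map_one, one_mul, colourPowerProd, Multiset.map_map, Finsupp.toMultiset_map,
      Finsupp.prod_toMultiset, Finsupp.prod_mapDomain_index (by simp) (fun _ _ _ => pow_add _ _ _)]
    simp only [pSeries_eq_colourPowerSum, Function.comp_apply]
  have := LinearMap.injective_of_linearIndependent
    (f := (MvPolynomial.aeval (R := ℂ) pSeries).toLinearMap)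
    (MvPolynomial.basisMonomials ℕ+ ℂ).span_eq (by simpa only [Function.comp_def, hmon] using hli')
  exact this

lemma aeval_p_bijective :
    Function.Bijective (MvPolynomial.aeval p : MvPolynomial ℕ+ ℂ →ₐ[ℂ] Lam) := by
  have hcomp : ∀ q : MvPolynomial ℕ+ ℂ, ((MvPolynomial.aeval p q : Lam) : MvPowerSeries ℕ ℂ) =
      MvPolynomial.aeval pSeries q := by
    intro q
    have : Lam.val.comp (MvPolynomial.aeval p) = MvPolynomial.aeval (R := ℂ) pSeries := by
      ext1 n; simp [p]
    exact DFunLike.congr_fun this q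
  refine ⟨fun q q' hq => aeval_p_injective ?_, fun f => ?_⟩
  · rw [← hcomp, ← hcomp, hq]
  · obtain ⟨d, hd⟩ := f.2.2
    have hf := mem_adjoin_pSeries (d + 1) f.1 f.2 fun α hα => hd α (by
      have : α.support.card ≤ α.degree := by
        rw [Finsupp.degree_apply, Finset.card_eq_sum_ones]
        exact Finset.sum_le_sum fun i hi => Nat.one_le_iff_ne_zero.2 (Finsupp.mem_support_iff.1 hi)
      omega)
    rw [Algebra.adjoin_range_eq_range_aeval] at hf
    obtain ⟨q, hq⟩ := hf
    exact ⟨q, Subtype.ext ((hcomp q).trans hq)⟩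

/-- `Λ` is the polynomial ring over `ℂ` in the power sums `p_1, p_2, …`. -/
def powerSumEquiv : MvPolynomial ℕ+ ℂ ≃ₐ[ℂ] Lam :=
  AlgEquiv.ofBijective (MvPolynomial.aeval p) aeval_p_bijective

/-- Plethystic substitution `F ↦ F(A)`: the `ℂ`-algebra homomorphism on `Λ` that sends `p_n` to
`p_n(A) = ∑ c_α t^{nα}`, where `A = ∑ c_α t^α`. -/
def pleth {τ : Type*} (A : MvPowerSeries τ ℂ) : Lam →ₐ[ℂ] MvPowerSeries τ ℂ :=
  (MvPolynomial.aeval fun n : ℕ+ => MvPowerSeries.expand (n : ℕ) n.ne_zero A).comp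
    (powerSumEquiv.symm : Lam →ₐ[ℂ] MvPolynomial ℕ+ ℂ)

lemma pleth_p {τ : Type*} (A : MvPowerSeries τ ℂ) (n : ℕ+) :
    pleth A (p n) = MvPowerSeries.expand (n : ℕ) n.ne_zero A := by
  have : powerSumEquiv.symm (p n) = MvPolynomial.X n := by
    rw [AlgEquiv.symm_apply_eq]
    simp [powerSumEquiv]
  simp [pleth, this]

/-- Two algebra homomorphisms on `Λ` that agree on the power sums are equal. -/
lemma Lam_algHom_ext {B : Type*} [Semiring B] [Algebra ℂ B] {φ ψ : Lam →ₐ[ℂ] B}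
    (H : ∀ n, φ (p n) = ψ (p n)) : φ = ψ := by
  have : φ.comp (powerSumEquiv : MvPolynomial ℕ+ ℂ →ₐ[ℂ] Lam) =
      ψ.comp (powerSumEquiv : MvPolynomial ℕ+ ℂ →ₐ[ℂ] Lam) := by
    ext1 n
    simpa [powerSumEquiv] using H n
  ext1 f
  obtain ⟨q, rfl⟩ := powerSumEquiv.surjective f
  exact DFunLike.congr_fun this q

lemma pleth_mem {τ : Type*} (A : MvPowerSeries τ ℂ) (B : Subalgebra ℂ (MvPowerSeries τ ℂ))
    (hB : ∀ n : ℕ+, MvPowerSeries.expand (n : ℕ) n.ne_zero A ∈ B) (f : Lam) : pleth A f ∈ B := by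
  have hle : Algebra.adjoin ℂ (Set.range fun n : ℕ+ =>
      MvPowerSeries.expand (n : ℕ) n.ne_zero A) ≤ B :=
    Algebra.adjoin_le (by rintro _ ⟨n, rfl⟩; exact hB n)
  apply hle
  rw [Algebra.adjoin_range_eq_range_aeval]
  exact ⟨powerSumEquiv.symm f, rfl⟩

/-! ### Wreath symmetric functions -/

section wreath
variable (ι : Type)

/-- The ring `R = ⨂_i Λ(X_i)` of wreath symmetric functions, realised as the subalgebra of
`ℂ[[x_{i,k}]]` generated by the rings `Λ(X_i)`, `X_i = x_{i,0} + x_{i,1} + ⋯`. -/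
def wreathRing : Subalgebra ℂ (MvPowerSeries (ι × ℕ) ℂ) :=
  ⨆ i : ι, Lam.map (MvPowerSeries.rename (Function.Embedding.sectR i ℕ))

variable {ι}

lemma rename_mem_wreathRing (i : ι) (f : Lam) :
    MvPowerSeries.rename (Function.Embedding.sectR i ℕ) (f : MvPowerSeries ℕ ℂ) ∈ wreathRing ι :=
  le_iSup (fun i : ι => Lam.map (MvPowerSeries.rename (Function.Embedding.sectR i ℕ))) i
    ⟨f, f.2, rfl⟩

/-- `f(X_i)`, the copy of a symmetric function `f` in the variable set `X_i`. -/
def inVars (f : Lam) (i : ι) : wreathRing ι :=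
  ⟨MvPowerSeries.rename (Function.Embedding.sectR i ℕ) (f : MvPowerSeries ℕ ℂ),
    rename_mem_wreathRing i f⟩

/-- `P_ρ = ∏_i p_{ρ(i)}(X_i)`. -/
def wreathP [Fintype ι] (ρ : ι → Par) : wreathRing ι := ∏ i, inVars (pPar (ρ i)) i

lemma rename_pSeries (i : ι) (n : ℕ+) :
    MvPowerSeries.rename (Function.Embedding.sectR i ℕ) (pSeries n) =
      colourPowerSum Prod.fst i n := by
  ext β
  rw [coeff_colourPowerSum]
  by_cases hβ : β ∈ Set.range (Finsupp.mapDomain (Function.Embedding.sectR i ℕ))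
  · obtain ⟨α, rfl⟩ := hβ
    rw [← Finsupp.embDomain_eq_mapDomain, MvPowerSeries.coeff_embDomain_rename]
    change (if ∃ k, α = Finsupp.single k (n : ℕ) then (1 : ℂ) else 0) = _
    refine if_congr ⟨?_, ?_⟩ rfl rfl
    · rintro ⟨k, rfl⟩
      exact ⟨(i, k), rfl, by simp [Finsupp.embDomain_single]⟩
    · rintro ⟨⟨i', k⟩, rfl, hk⟩
      refine ⟨k, Finsupp.embDomain_injective (Function.Embedding.sectR i' ℕ) ?_⟩
      rw [hk, Finsupp.embDomain_single]
      rfl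
  · rw [MvPowerSeries.coeff_rename_eq_zero _ _ hβ, if_neg]
    rintro ⟨⟨i', k⟩, rfl, rfl⟩
    exact hβ ⟨Finsupp.single k n, by rw [Finsupp.mapDomain_single]; rfl⟩

lemma inVars_pPar (lam : Par) (i : ι) : (inVars (pPar lam) i : MvPowerSeries (ι × ℕ) ℂ) =
    colourPowerProd Prod.fst (lam.map fun n => (i, n)) := by
  change MvPowerSeries.rename (Function.Embedding.sectR i ℕ) (Lam.val (pPar lam)) = _
  rw [pPar, map_multiset_prod, map_multiset_prod, colourPowerProd]
  simp only [Multiset.map_map]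
  congr 1
  refine Multiset.map_congr rfl fun n _ => ?_
  exact rename_pSeries i n

/-- The coloured multiset of parts of a family of partitions. -/
def colouredParts [Fintype ι] (ρ : ι → Par) : Multiset (ι × ℕ+) :=
  ∑ i, (ρ i).map fun n => (i, n)

lemma coe_wreathP [Fintype ι] (ρ : ι → Par) : (wreathP ρ : MvPowerSeries (ι × ℕ) ℂ) =
    colourPowerProd Prod.fst (colouredParts ρ) := by
  have hadd : ∀ (T : Finset ι), colourPowerProd (Prod.fst : ι × ℕ → ι)
      (∑ i ∈ T, (ρ i).map fun n => (i, n)) =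
      ∏ i ∈ T, colourPowerProd Prod.fst ((ρ i).map fun n => (i, n)) := by
    intro T
    induction T using Finset.induction_on with
    | empty => simp [colourPowerProd]
    | insert i T hi ih =>
      rw [Finset.sum_insert hi, Finset.prod_insert hi, ← ih]
      simp [colourPowerProd]
  rw [colouredParts, hadd, wreathP]
  change (wreathRing ι).val _ = _
  rw [map_prod]
  exact Finset.prod_congr rfl fun i _ => inVars_pPar (ρ i) i

lemma filter_colouredParts [Fintype ι] (ρ : ι → Par) (j : ι) :
    ((colouredParts ρ).filter fun x => x.1 = j).map Prod.snd = ρ j := by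
  have : ∀ T : Finset ι, ((∑ i ∈ T, (ρ i).map fun n => (i, n)).filter fun x => x.1 = j).map Prod.snd
      = if j ∈ T then ρ j else 0 := by
    intro T
    induction T using Finset.induction_on with
    | empty => simp
    | insert i T hi ih =>
      rw [Finset.sum_insert hi, Multiset.filter_add, Multiset.map_add, ih, Multiset.filter_map,
        Multiset.map_map]
      by_cases hij : i = j
      · subst hij; simp [hi]
      · simp [hij, Ne.symm hij]
  simpa [colouredParts] using this Finset.univ

lemma colouredParts_injective [Fintype ι] : Function.Injective (colouredParts (ι := ι)) := by
  intro ρ ρ' hρ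
  funext j
  rw [← filter_colouredParts ρ j, hρ, filter_colouredParts]

lemma colouredParts_surjective [Fintype ι] : Function.Surjective (colouredParts (ι := ι)) := by
  intro s
  refine ⟨fun j => (s.filter fun x => x.1 = j).map Prod.snd, ?_⟩
  induction s using Multiset.induction_on with
  | empty => simp [colouredParts]
  | cons x s ih =>
    conv_rhs => rw [← ih]
    unfold colouredParts
    have : ∀ i, (((x ::ₘ s).filter fun y => y.1 = i).map Prod.snd).map (fun n => (i, n)) =
        (if x.1 = i then {x} else 0) +
          ((s.filter fun y => y.1 = i).map Prod.snd).map fun n => (i, n) := by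
      intro i
      by_cases hx : x.1 = i
      · subst hx; simp
      · simp [hx]
    simp only [this, Finset.sum_add_distrib, Finset.sum_ite_eq, Finset.mem_univ, if_true,
      Multiset.singleton_add]

lemma linearIndependent_wreathP [Fintype ι] :
    LinearIndependent ℂ (wreathP : (ι → Par) → wreathRing ι) := by
  have hli := (linearIndependent_colourPowerProd (Prod.fst : ι × ℕ → ι) (fun i => by
    refine (Set.infinite_range_of_injective
      (Function.Embedding.sectR i ℕ).injective).mono ?_
    rintro _ ⟨k, rfl⟩; rfl)).comp _ (colouredParts_injective (ι := ι))
  refine LinearIndependent.of_comp (wreathRing ι).val.toLinearMap ?_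
  have heq : (⇑(wreathRing ι).val.toLinearMap ∘ wreathP) =
      colourPowerProd (Prod.fst : ι × ℕ → ι) ∘ colouredParts := funext fun ρ => coe_wreathP ρ
  rw [heq]
  exact hli

lemma wreathRing_le_adjoin : wreathRing ι ≤ Algebra.adjoin ℂ
    (Set.range fun x : ι × ℕ+ => colourPowerSum (Prod.fst : ι × ℕ → ι) x.1 x.2) := by
  refine iSup_le fun i => ?_
  rintro _ ⟨f, hf, rfl⟩
  obtain ⟨q, hq⟩ := powerSumEquiv.surjective ⟨f, hf⟩
  have hcomp : ((MvPowerSeries.rename (Function.Embedding.sectR i ℕ)).comp Lam.val).comp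
      (powerSumEquiv : MvPolynomial ℕ+ ℂ →ₐ[ℂ] Lam) =
      MvPolynomial.aeval fun n : ℕ+ => colourPowerSum (Prod.fst : ι × ℕ → ι) i n := by
    ext1 n
    simpa [powerSumEquiv, p] using rename_pSeries i n
  have hf' : MvPowerSeries.rename (Function.Embedding.sectR i ℕ) f =
      MvPolynomial.aeval (fun n : ℕ+ => colourPowerSum (Prod.fst : ι × ℕ → ι) i n) q := by
    rw [← hcomp, AlgHom.comp_apply, AlgHom.comp_apply]
    exact congrArg _ (congrArg Lam.val hq.symm)
  have hmem : MvPolynomial.aeval (fun n : ℕ+ => colourPowerSum (Prod.fst : ι × ℕ → ι) i n) q ∈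
      Algebra.adjoin ℂ (Set.range fun n : ℕ+ => colourPowerSum (Prod.fst : ι × ℕ → ι) i n) := by
    rw [Algebra.adjoin_range_eq_range_aeval]
    exact ⟨q, rfl⟩
  rw [← hf'] at hmem
  refine Algebra.adjoin_mono ?_ hmem
  rintro _ ⟨n, rfl⟩
  exact ⟨(i, n), rfl⟩

lemma span_wreathP [Fintype ι] :
    ⊤ ≤ Submodule.span ℂ (Set.range (wreathP : (ι → Par) → wreathRing ι)) := by
  rintro ⟨f, hf⟩ -
  have := wreathRing_le_adjoin hf
  rw [Algebra.adjoin_range_eq_range_aeval] at this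
  obtain ⟨q, hq⟩ := this
  have key : f ∈ Submodule.span ℂ
      (Set.range fun ρ : ι → Par => (wreathP ρ : MvPowerSeries (ι × ℕ) ℂ)) := by
    rw [← hq, ← q.support_sum_monomial_coeff]
    change MvPolynomial.aeval _ _ ∈ _
    rw [map_sum]
    refine Submodule.sum_mem _ fun d _ => ?_
    have : MvPolynomial.monomial d (q.coeff d) = q.coeff d • MvPolynomial.monomial d (1 : ℂ) := by
      rw [MvPolynomial.smul_monomial, smul_eq_mul, mul_one]
    rw [this, map_smul, aeval_monomial_colourPowerSum]
    obtain ⟨ρ, hρ⟩ := colouredParts_surjective (Finsupp.toMultiset d)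
    rw [← hρ, ← coe_wreathP]
    exact Submodule.smul_mem _ _ (Submodule.subset_span ⟨ρ, rfl⟩)
  have hmap : (Submodule.span ℂ (Set.range (wreathP : (ι → Par) → wreathRing ι))).map
      (wreathRing ι).val.toLinearMap = Submodule.span ℂ
      (Set.range fun ρ : ι → Par => (wreathP ρ : MvPowerSeries (ι × ℕ) ℂ)) := by
    rw [Submodule.map_span, ← Set.range_comp]
    rfl
  rw [← hmap] at key
  obtain ⟨g, hg, hgf⟩ := key
  rwa [show (⟨f, hf⟩ : wreathRing ι) = g from Subtype.ext hgf.symm]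

/-- The basis `(P_ρ)` of `R`. -/
def wreathBasis (ι : Type) [Fintype ι] : Module.Basis (ι → Par) ℂ (wreathRing ι) :=
  Module.Basis.mk linearIndependent_wreathP span_wreathP

/-- `Z_ρ = ∏_i z_{ρ(i)} m ^ ℓ(ρ(i))`, where `m` is the number of variable sets. -/
def zWreath [Fintype ι] (ρ : ι → Par) : ℕ :=
  ∏ i, zPar (ρ i) * Fintype.card ι ^ (ρ i).card

/-- The bilinear pairing on `R` with `(P_ρ, P_γ) = δ_{ρ,γ} Z_ρ`. -/
def wreathPairing [Fintype ι] : wreathRing ι →ₗ[ℂ] wreathRing ι →ₗ[ℂ] ℂ :=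
  (wreathBasis ι).constr ℂ fun ρ => (wreathBasis ι).constr ℂ fun γ =>
    if ρ = γ then (zWreath ρ : ℂ) else 0

/-- `∑ a_ρ P_ρ ↦ ∑ conj(a_ρ) P_ρ`. -/
def wreathConj [Fintype ι] (f : wreathRing ι) : wreathRing ι :=
  ((wreathBasis ι).repr f).sum fun ρ a => (starRingEnd ℂ) a • wreathP ρ

/-- The coefficient of `y^β` in a series in the variables `x_{i,k}` and `y_k`. -/
def coeffY (β : ℕ →₀ ℕ) (F : MvPowerSeries ((ι × ℕ) ⊕ ℕ) ℂ) : MvPowerSeries (ι × ℕ) ℂ :=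
  fun α => MvPowerSeries.coeff (Finsupp.sumElim α β) F

/-- The pairing `(F, f)` of a series `F` in the `x_{i,k}` and `y_k` with `f ∈ R`, extended linearly
over series in `Y` and over infinite sums of homogeneous elements of `R`: the coefficient of `y^β`
in `(F, f)` is `∑_d (F_{β,d}, f)`, where `F_{β,d}` is the component of degree `d` in the `x_{i,k}`
of the coefficient of `y^β` in `F`. (It is meant for `F` all of whose `F_{β,d}` lie in `R`;
other components are ignored.) -/
def seriesPairing [Fintype ι] (F : MvPowerSeries ((ι × ℕ) ⊕ ℕ) ℂ) (f : wreathRing ι) :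
    MvPowerSeries ℕ ℂ :=
  fun β => ∑ᶠ d : ℕ,
    if hR : MvPowerSeries.homogeneousComponent d (coeffY β F) ∈ wreathRing ι then
      wreathPairing ⟨MvPowerSeries.homogeneousComponent d (coeffY β F), hR⟩ f
    else 0

end wreath

/-! ### The kernel and the functions `S_ρ`, `G_ρ` -/

section kernel
open scoped MvPowerSeries.WithPiTopology

/-- The plethystic exponential `Ω(A) = ∑_{n ≥ 0} h_n(A)`. -/
def plethExp {τ : Type*} (A : MvPowerSeries τ ℂ) : MvPowerSeries τ ℂ := ∑' n : ℕ, pleth A (h n)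

/-- `Ω(Y; z) = ∏_i (1 - z y_i)⁻¹`. -/
def OmegaAt (z : ℂ) : MvPowerSeries ℕ ℂ :=
  ∏' i : ℕ, (1 - z • (MvPowerSeries.X i : MvPowerSeries ℕ ℂ))⁻¹

/-- `∑_{k ≥ 0} h_{km+j}(Y)`. -/
def hProgression (m j : ℕ) : MvPowerSeries ℕ ℂ := ∑' k : ℕ, (h (k * m + j) : MvPowerSeries ℕ ℂ)

variable (m : ℕ) [NeZero m]

/-- `μ_m`, the group of `m`-th roots of unity in `ℂ`. -/
abbrev Mu (m : ℕ) : Type := rootsOfUnity m ℂ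

instance : Fintype (Mu m) := Fintype.ofFinite _

/-- `ζ_m = exp(2πi/m)` as an element of `μ_m`. -/
def zetaM : Mu m := (Complex.isPrimitiveRoot_exp m (NeZero.ne m)).toRootsOfUnity

/-- The complex number underlying a root of unity. -/
def muVal {m : ℕ} (ζ : Mu m) : ℂ := ((ζ : ℂˣ) : ℂ)

/-- `φ_j(𝔛) = (1/m) ∑_ζ ζ^j X_ζ`, with `X_ζ = x_{ζ,0} + x_{ζ,1} + ⋯ = p_1(X_ζ)`. -/
def phi (j : ℕ) : MvPowerSeries (Mu m × ℕ) ℂ :=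
  (1 / (m : ℂ)) • ∑ ζ : Mu m, muVal ζ ^ j • (inVars (p 1) ζ : MvPowerSeries (Mu m × ℕ) ℂ)

lemma expand_colourPowerSum {σ ι : Type*} (c : σ → ι) (i : ι) (n : ℕ+) :
    MvPowerSeries.expand (n : ℕ) n.ne_zero (colourPowerSum c i 1) = colourPowerSum c i n := by
  ext β
  by_cases hβ : ∃ α, β = (n : ℕ) • α
  · obtain ⟨α, rfl⟩ := hβ
    rw [MvPowerSeries.coeff_expand_smul, coeff_colourPowerSum, coeff_colourPowerSum]
    refine if_congr (exists_congr fun v => and_congr_right fun _ => ?_) rfl rfl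
    have : Finsupp.single v (n : ℕ) = (n : ℕ) • Finsupp.single v 1 := by simp
    rw [this]
    exact (nsmul_right_inj n.ne_zero).symm
  · rw [coeff_colourPowerSum, if_neg]
    · by_contra hne
      obtain ⟨α, -, hα⟩ := MvPowerSeries.support_expand_subset (n : ℕ) n.ne_zero _ hne
      exact hβ ⟨α, hα.symm⟩
    · rintro ⟨v, -, rfl⟩
      exact hβ ⟨Finsupp.single v 1, by simp⟩

lemma expand_phi_mem (j : ℕ) (n : ℕ+) :
    MvPowerSeries.expand (n : ℕ) n.ne_zero (phi m j) ∈ wreathRing (Mu m) := by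
  rw [phi, map_smul, map_sum]
  refine Subalgebra.smul_mem _ (Subalgebra.sum_mem _ fun ζ _ => ?_) _
  rw [map_smul]
  refine Subalgebra.smul_mem _ ?_ _
  change MvPowerSeries.expand (n : ℕ) n.ne_zero
    (MvPowerSeries.rename (Function.Embedding.sectR ζ ℕ) (pSeries 1)) ∈ _
  rw [rename_pSeries, PNat.one_coe, expand_colourPowerSum, ← rename_pSeries]
  exact rename_mem_wreathRing ζ (p n)

/-- `S_ρ(𝔛) = ∏_{1 ≤ j ≤ m} s_{ρ(ζ_m^j)}(φ_j(𝔛))`. -/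
def wreathS (ρ : Mu m → Par) : wreathRing (Mu m) :=
  ∏ j ∈ Finset.Icc 1 m, ⟨pleth (phi m j) (schur (ρ (zetaM m ^ j))),
    pleth_mem _ _ (expand_phi_mem m j) _⟩

/-- The series `(1/m) ∑_ζ X_ζ Ω(Y;ζ)`. -/
def kernelAlphabet : MvPowerSeries ((Mu m × ℕ) ⊕ ℕ) ℂ :=
  (1 / (m : ℂ)) • ∑ ζ : Mu m,
    MvPowerSeries.rename (Function.Embedding.inl : Mu m × ℕ ↪ (Mu m × ℕ) ⊕ ℕ)
        (inVars (p 1) ζ : MvPowerSeries (Mu m × ℕ) ℂ) *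
      MvPowerSeries.rename (Function.Embedding.inr : ℕ ↪ (Mu m × ℕ) ⊕ ℕ) (OmegaAt (muVal ζ))

/-- `G_ρ(Y) = (Ω((1/m) ∑_ζ X_ζ Ω(Y;ζ)), conj S_ρ(𝔛))`. -/
def G (ρ : Mu m → Par) : MvPowerSeries ℕ ℂ :=
  seriesPairing (plethExp (kernelAlphabet m)) (wreathConj (wreathS m ρ))

end kernel

end

end WreathSym

/-! The kernel is a reproducing kernel. Plethysm does not raise coefficients to powers, so `p_n` of
`(1/m) ∑ X_ζ g_ζ(Y)` is `(1/m) ∑ p_n(X_ζ) p_n(g_ζ)`. Exponentiating through Newton's identities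
gives the Cauchy expansion `∑_ρ Z_ρ⁻¹ P_ρ(X) P_ρ(g)`, where `P_ρ(g)` is `P_ρ` with each `p_r(X_ζ)`
replaced by `p_r(g_ζ)` (`pleth_kernelOf_h`, `zCol_colouredParts`). Pairing with `f` therefore
substitutes `g_ζ` for `X_ζ` in `f`, which is an algebra homomorphism (`seriesPairing_plethExp`,
`evalHom`).

Take `g_ζ = Ω(Y;ζ) = ∑ ζ^n h_n(Y)`. Conjugation turns `φ_j` into `(1/m) ∑ ζ^{-j} X_ζ`, and the
substitution turns this into `(1/m) ∑ ζ^{-j} Ω(Y;ζ)`. By orthogonality of characters this is `∑_k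
h_{km+j}(Y)` (`sum_conj_smul_OmegaAt`). The product over `j` follows by multiplicativity.

Conjugation is only semilinear, so the composite map on `Λ` is handled as a ring homomorphism. Its
values on the `p_n` still determine its values on Schur functions, which are integral determinants
in the `h_n`, themselves rational polynomials in the `p_n` (`ringHom_schur_eq`). -/

namespace WreathSym

noncomputable section

open scoped Classical MvPowerSeries.WithPiTopology

/-! ### Newton's identities -/

/-- A factorisation of `x^α` counted here is a choice of `i` with `x_i^k` dividing `x^α`; the
cofactor then has degree `l` automatically. -/
lemma coeff_pSeries_mul_hSeries (k : ℕ+) (l : ℕ) (α : ℕ →₀ ℕ) (hα : α.degree = k + l) :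
    MvPowerSeries.coeff α (pSeries k * hSeries l) =
      ∑ i ∈ α.support, if (k : ℕ) ≤ α i then (1 : ℂ) else 0 := by
  have hp : ∀ x ∈ Finset.HasAntidiagonal.antidiagonal α, MvPowerSeries.coeff x.1 (pSeries k) *
      MvPowerSeries.coeff x.2 (hSeries l) =
      ∑ i ∈ α.support, if x.1 = Finsupp.single i (k : ℕ) then (1 : ℂ) else 0 := by
    rintro ⟨a, b⟩ hx
    rw [Finset.HasAntidiagonal.mem_antidiagonal] at hx
    dsimp only at hx ⊢
    change (if ∃ i, a = Finsupp.single i (k : ℕ) then (1 : ℂ) else 0) *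
      (if b.degree = l then 1 else 0) = _
    by_cases ha : ∃ i, a = Finsupp.single i (k : ℕ)
    · obtain ⟨i, rfl⟩ := ha
      have hb : b.degree = l := by
        have := congrArg Finsupp.degree hx
        rw [map_add, Finsupp.degree_single] at this
        omega
      rw [if_pos ⟨i, rfl⟩, if_pos hb, one_mul, Finset.sum_eq_single i, if_pos rfl]
      · intro j _ hj
        rw [if_neg]
        intro h
        exact hj ((Finsupp.single_left_inj k.ne_zero).1 h).symm
      · intro hi
        rw [Finsupp.notMem_support_iff, ← hx] at hi
        simp at hi
    · rw [if_neg ha, zero_mul, Finset.sum_eq_zero]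
      exact fun i _ => if_neg fun h => ha ⟨i, h⟩
  rw [MvPowerSeries.coeff_mul, Finset.sum_congr rfl hp, Finset.sum_comm]
  refine Finset.sum_congr rfl fun i _ => ?_
  split_ifs with hi
  · have hle : Finsupp.single i (k : ℕ) ≤ α := by simpa using hi
    rw [Finset.sum_eq_single (Finsupp.single i (k : ℕ), α - Finsupp.single i (k : ℕ)), if_pos rfl]
    · rintro ⟨a, b⟩ hx hne
      rw [Finset.HasAntidiagonal.mem_antidiagonal] at hx
      refine if_neg fun h => hne ?_
      dsimp only at h hx
      subst h
      rw [← hx, add_tsub_cancel_left]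
    · intro h
      exact absurd (Finset.HasAntidiagonal.mem_antidiagonal.2 (add_tsub_cancel_of_le hle)) h
  · refine Finset.sum_eq_zero fun x hx => if_neg fun h => hi ?_
    rw [Finset.HasAntidiagonal.mem_antidiagonal, h] at hx
    rw [← hx]
    simp

/-- Newton's identity `(n + 1) h_{n+1} = ∑_{k ≤ n} p_{k+1} h_{n-k}`. -/
lemma newton_h (n : ℕ) :
    ((n + 1 : ℕ) : Lam) * h (n + 1) = ∑ k ∈ Finset.range (n + 1), p k.succPNat * h (n - k) := by
  apply Subtype.ext
  change Lam.val (((n + 1 : ℕ) : Lam) * h (n + 1)) =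
    Lam.val (∑ k ∈ Finset.range (n + 1), p k.succPNat * h (n - k))
  rw [map_mul, map_natCast, map_sum, ← nsmul_eq_mul]
  simp only [map_mul]
  change (n + 1) • hSeries (n + 1) =
    ∑ k ∈ Finset.range (n + 1), pSeries k.succPNat * hSeries (n - k)
  ext α
  rw [map_nsmul, map_sum]
  by_cases hα : α.degree = n + 1
  · have hterm : ∀ k ∈ Finset.range (n + 1),
        MvPowerSeries.coeff α (pSeries k.succPNat * hSeries (n - k)) =
        ∑ i ∈ α.support, if k < α i then (1 : ℂ) else 0 := by
      intro k hk
      rw [Finset.mem_range] at hk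
      rw [coeff_pSeries_mul_hSeries _ _ _ (by rw [Nat.succPNat_coe]; omega)]
      rfl
    rw [Finset.sum_congr rfl hterm, Finset.sum_comm]
    -- The variable `x_i` is counted once for each `k < α i`; summing `α i` over `i` gives the
    -- degree `n + 1`.
    have hin : ∀ i ∈ α.support, ∑ k ∈ Finset.range (n + 1), (if k < α i then (1 : ℂ) else 0) =
        (α i : ℂ) := by
      intro i _
      have hle : α i ≤ n + 1 := hα ▸ Finsupp.le_degree i α
      have : (Finset.range (n + 1)).filter (fun k => k < α i) = Finset.range (α i) := by
        ext k; simp; omega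
      rw [Finset.sum_boole, this, Finset.card_range]
    rw [Finset.sum_congr rfl hin, ← Nat.cast_sum, ← Finsupp.degree_apply, hα]
    change (n + 1) • (if α.degree = n + 1 then (1 : ℂ) else 0) = _
    rw [if_pos hα]
    simp
  · have h1 : MvPowerSeries.coeff α (hSeries (n + 1)) = 0 := if_neg hα
    rw [h1, smul_zero, Finset.sum_eq_zero]
    intro k hk
    rw [Finset.mem_range] at hk
    rw [MvPowerSeries.coeff_mul]
    refine Finset.sum_eq_zero fun x hx => ?_
    rw [Finset.HasAntidiagonal.mem_antidiagonal] at hx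
    change (if ∃ i, x.1 = Finsupp.single i (k.succPNat : ℕ) then (1 : ℂ) else 0) *
      (if x.2.degree = n - k then 1 else 0) = 0
    by_cases h1 : ∃ i, x.1 = Finsupp.single i (k.succPNat : ℕ)
    · obtain ⟨i, hi⟩ := h1
      rw [if_neg (c := x.2.degree = n - k), mul_zero]
      intro h2
      apply hα
      rw [← hx, map_add, hi, Finsupp.degree_single, h2, Nat.succPNat_coe]
      omega
    · rw [if_neg h1, zero_mul]

lemma h_zero : h 0 = 1 := by
  apply Subtype.ext
  change hSeries 0 = 1
  ext α
  rw [MvPowerSeries.coeff_one]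
  change (if α.degree = 0 then (1 : ℂ) else 0) = _
  exact if_congr (Finsupp.degree_eq_zero_iff α) rfl rfl

/-- Ring homomorphisms on `Λ` that agree on power sums agree on the `h_n`. -/
lemma ringHom_h_eq {B : Type*} [CommRing B] [Algebra ℚ B] {φ ψ : Lam →+* B}
    (H : ∀ n, φ (p n) = ψ (p n)) (n : ℕ) : φ (h n) = ψ (h n) := by
  induction n using Nat.strong_induction_on with
  | _ n ih =>
    cases n with
    | zero => rw [h_zero, map_one, map_one]
    | succ n =>
      have key : ((n + 1 : ℕ) : B) * φ (h (n + 1)) = ((n + 1 : ℕ) : B) * ψ (h (n + 1)) := by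
        rw [← map_natCast φ, ← map_mul, newton_h, map_sum, map_natCast φ, ← map_natCast ψ,
          ← map_mul, newton_h, map_sum]
        refine Finset.sum_congr rfl fun k hk => ?_
        rw [map_mul, map_mul, H, ih (n - k) (by omega)]
      -- Over `ℚ` the factor `n + 1` is invertible, so Newton's recursion can be solved for
      -- `h_{n+1}`.
      have hu : IsUnit ((n + 1 : ℕ) : B) := by
        rw [← map_natCast (algebraMap ℚ B)]
        exact (IsUnit.mk0 _ (by positivity)).map _
      exact hu.mul_left_cancel key

/-- Schur functions have integer coefficients in the `h_n`, so ring homomorphisms on `Λ` that agree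
on power sums agree on Schur functions. -/
lemma ringHom_schur_eq {B : Type*} [CommRing B] [Algebra ℚ B] {φ ψ : Lam →+* B}
    (H : ∀ n, φ (p n) = ψ (p n)) (lam : Par) : φ (schur lam) = ψ (schur lam) := by
  have hI : ∀ k, φ (hInt k) = ψ (hInt k) := by
    rintro (k | k)
    · exact ringHom_h_eq H k
    · change φ 0 = ψ 0
      rw [map_zero, map_zero]
  rw [schur, RingHom.map_det, RingHom.map_det]
  congr 1
  ext i j
  exact hI _

/-! ### The series `Ω(Y; z)` and the progressions of complete functions -/

/-- The series `∑ z ^ |α| y ^ α` over the monomials supported in `s`. -/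
def geomSeries (z : ℂ) (s : Finset ℕ) : MvPowerSeries ℕ ℂ :=
  fun α => if α.support ⊆ s then z ^ α.degree else 0

lemma coeff_geomSeries (z : ℂ) (s : Finset ℕ) (α : ℕ →₀ ℕ) :
    MvPowerSeries.coeff α (geomSeries z s) = if α.support ⊆ s then z ^ α.degree else 0 := rfl

lemma geomSeries_empty (z : ℂ) : geomSeries z ∅ = 1 := by
  ext α
  rw [coeff_geomSeries, MvPowerSeries.coeff_one]
  by_cases hα : α = 0 <;> simp [hα]

/-- Telescoping: a monomial divisible by `y_i` cancels against `z y_i` times its quotient by `y_i`,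
and the monomials free of `y_i` remain. -/
lemma geomSeries_insert_mul (z : ℂ) (s : Finset ℕ) (i : ℕ) (hi : i ∉ s) :
    geomSeries z (insert i s) * (1 - z • (MvPowerSeries.X i : MvPowerSeries ℕ ℂ)) =
      geomSeries z s := by
  ext α
  rw [mul_sub, mul_one, mul_smul_comm, map_sub, map_smul, smul_eq_mul]
  by_cases hα : α i = 0
  · have h0 : MvPowerSeries.coeff α (geomSeries z (insert i s) * MvPowerSeries.X i) = 0 := by
      rw [MvPowerSeries.X, MvPowerSeries.coeff_mul_monomial, if_neg]
      intro h
      have := h i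
      simp [hα] at this
    rw [h0, mul_zero, sub_zero, coeff_geomSeries, coeff_geomSeries]
    refine if_congr ⟨fun h v hv => ?_, fun h => h.trans (Finset.subset_insert _ _)⟩ rfl rfl
    rcases Finset.mem_insert.1 (h hv) with rfl | h'
    · exact absurd hα (Finsupp.mem_support_iff.1 hv)
    · exact h'
  · obtain ⟨β, rfl⟩ : ∃ β, α = β + Finsupp.single i 1 :=
      ⟨α - Finsupp.single i 1, (tsub_add_cancel_of_le (by
        simpa using Nat.one_le_iff_ne_zero.2 hα)).symm⟩
    rw [MvPowerSeries.X, MvPowerSeries.coeff_add_mul_monomial, mul_one, coeff_geomSeries,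
      coeff_geomSeries, coeff_geomSeries, map_add, Finsupp.degree_single, pow_succ']
    have hs : (β + Finsupp.single i 1).support = insert i β.support := by
      ext w
      by_cases hw : w = i
      · subst hw; simp
      · simp [hw]
    rw [hs, if_neg (c := insert i β.support ⊆ s) (fun h => hi (h (Finset.mem_insert_self _ _)))]
    have hiff : insert i β.support ⊆ insert i s ↔ β.support ⊆ insert i s := by
      rw [Finset.insert_subset_iff]
      simp
    rw [if_congr hiff rfl rfl]
    split_ifs <;> simp

lemma prod_inv_eq_geomSeries (z : ℂ) (s : Finset ℕ) :
    ∏ i ∈ s, (1 - z • (MvPowerSeries.X i : MvPowerSeries ℕ ℂ))⁻¹ = geomSeries z s := by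
  induction s using Finset.induction_on with
  | empty => rw [Finset.prod_empty, geomSeries_empty]
  | insert i s hi ih =>
    -- The inverse of a power series is a genuine inverse only when the constant coefficient is
    -- nonzero; here it is 1.
    have hc : MvPowerSeries.constantCoeff (1 - z • (MvPowerSeries.X i : MvPowerSeries ℕ ℂ)) ≠ 0 := by
      simp [MvPowerSeries.smul_eq_C_mul]
    rw [Finset.prod_insert hi, ih, mul_comm, eq_comm, MvPowerSeries.eq_mul_inv_iff_mul_eq hc,
      geomSeries_insert_mul z s i hi]

/-- The series `∑ g(|α|) y ^ α`. -/
def degreeSeries (g : ℕ → ℂ) : MvPowerSeries ℕ ℂ := fun α => g α.degree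

lemma coeff_degreeSeries (g : ℕ → ℂ) (α : ℕ →₀ ℕ) :
    MvPowerSeries.coeff α (degreeSeries g) = g α.degree := rfl

/-- `Ω(Y; z) = ∑ z ^ |α| y ^ α`. -/
lemma coeff_OmegaAt (z : ℂ) (α : ℕ →₀ ℕ) :
    MvPowerSeries.coeff α (OmegaAt z) = z ^ α.degree := by
  have hp : HasProd (fun i : ℕ => (1 - z • (MvPowerSeries.X i : MvPowerSeries ℕ ℂ))⁻¹)
      (degreeSeries fun d => z ^ d) := by
    unfold HasProd
    simp only [prod_inv_eq_geomSeries]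
    rw [MvPowerSeries.WithPiTopology.tendsto_iff_coeff_tendsto]
    intro β
    -- The coefficient of `y^β` no longer changes once the finite set of factors contains the
    -- support of `β`.
    refine tendsto_const_nhds.congr' ?_
    filter_upwards [Filter.eventually_ge_atTop β.support] with s hs
    rw [coeff_geomSeries, if_pos hs, coeff_degreeSeries]
  rw [OmegaAt, hp.tprod_eq, coeff_degreeSeries]

/-- A monomial of degree `d` occurs only in `h_d`, and since `j < m` the equation `d = km + j`
forces `k = d / m`. -/
lemma coeff_hProgression (m j : ℕ) (hj : j < m) (α : ℕ →₀ ℕ) :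
    MvPowerSeries.coeff α (hProgression m j) = if α.degree % m = j then 1 else 0 := by
  have hp : HasSum (fun k : ℕ => (h (k * m + j) : MvPowerSeries ℕ ℂ))
      (degreeSeries fun d => if d % m = j then 1 else 0) := by
    rw [MvPowerSeries.WithPiTopology.hasSum_iff_hasSum_coeff]
    intro β
    -- The index `k = d / m` serves for every residue: if `d % m ≠ j`, its term vanishes as well.
    have hb : MvPowerSeries.coeff β (degreeSeries fun d => if d % m = j then 1 else 0) = MvPowerSeries.coeff β (h (β.degree / m * m + j) :
        MvPowerSeries ℕ ℂ) := by
      change (if β.degree % m = j then (1 : ℂ) else 0) =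
        if β.degree = β.degree / m * m + j then 1 else 0
      refine if_congr ?_ rfl rfl
      have := Nat.div_add_mod' β.degree m
      omega
    rw [hb]
    refine hasSum_single _ fun k hk => if_neg fun hd => hk ?_
    rw [hd, mul_comm, Nat.mul_add_div (by omega), Nat.div_eq_of_lt hj, add_zero]
  rw [hProgression, hp.tsum_eq, coeff_degreeSeries]

/-! ### The exponential formula for coloured multisets -/

section coloured
variable {ι : Type}

/-- The sum of the parts of a coloured multiset. -/
def weight (s : Multiset (ι × ℕ+)) : ℕ := (s.map fun x => (x.2 : ℕ)).sum

lemma weight_cons (x : ι × ℕ+) (s : Multiset (ι × ℕ+)) : weight (x ::ₘ s) = x.2 + weight s := by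
  simp [weight]

lemma weight_eq_sum (s : Multiset (ι × ℕ+)) :
    weight s = ∑ x ∈ s.toFinset, s.count x * (x.2 : ℕ) := by
  rw [weight, Finset.sum_multiset_map_count]
  simp

/-- `∏_x m_x! (m r_x) ^ m_x`, where `m_x` is the multiplicity of the coloured part `x` and `r_x` its
size. -/
def zCol (m : ℕ) (s : Multiset (ι × ℕ+)) : ℕ :=
  ∏ x ∈ s.toFinset, (s.count x).factorial * (m * (x.2 : ℕ)) ^ s.count x

/-- Parts of multiplicity zero contribute 1, so two multisets can be compared factor by factor over
a common index set. -/
lemma zCol_eq_prod (m : ℕ) (s : Multiset (ι × ℕ+)) (T : Finset (ι × ℕ+)) (hT : s.toFinset ⊆ T) :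
    zCol m s = ∏ x ∈ T, (s.count x).factorial * (m * (x.2 : ℕ)) ^ s.count x := by
  refine Finset.prod_subset hT fun x _ hx => ?_
  rw [Multiset.mem_toFinset] at hx
  simp [Multiset.count_eq_zero_of_notMem hx]

lemma zCol_cons (m : ℕ) (x : ι × ℕ+) (s : Multiset (ι × ℕ+)) :
    zCol m (x ::ₘ s) = (s.count x + 1) * (m * x.2) * zCol m s := by
  have hx : x ∈ insert x s.toFinset := Finset.mem_insert_self _ _
  rw [zCol_eq_prod m s _ (Finset.subset_insert x _),
    zCol_eq_prod m (x ::ₘ s) (insert x s.toFinset) (by simp),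
    ← Finset.mul_prod_erase _ _ hx, ← Finset.mul_prod_erase _ _ hx, Multiset.count_cons_self,
    Nat.factorial_succ, pow_succ]
  have : ∀ y ∈ (insert x s.toFinset).erase x,
      ((x ::ₘ s).count y).factorial * (m * (y.2 : ℕ)) ^ (x ::ₘ s).count y =
      (s.count y).factorial * (m * (y.2 : ℕ)) ^ s.count y := by
    intro y hy
    rw [Multiset.count_cons_of_ne (Finset.ne_of_mem_erase hy)]
  rw [Finset.prod_congr rfl this]
  ring

lemma zCol_ne_zero (m : ℕ) [NeZero m] (s : Multiset (ι × ℕ+)) : zCol m s ≠ 0 :=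
  Finset.prod_ne_zero_iff.2 fun x _ => mul_ne_zero (Nat.factorial_ne_zero _)
    (pow_ne_zero _ (mul_ne_zero (NeZero.ne m) x.2.ne_zero))

lemma count_colouredParts [Fintype ι] (ρ : ι → Par) (i : ι) (r : ℕ+) :
    (colouredParts ρ).count (i, r) = (ρ i).count r := by
  rw [colouredParts, Multiset.count_sum', Finset.sum_eq_single i]
  · exact Multiset.count_map_eq_count' _ _ (Prod.mk_right_injective i) r
  · intro j _ hj
    refine Multiset.count_eq_zero_of_notMem fun h => hj ?_
    obtain ⟨n, -, hn⟩ := Multiset.mem_map.1 h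
    exact (Prod.ext_iff.1 hn).1
  · simp

/-- Since `ℓ(ρ(i))` is the sum of the multiplicities, the power `m^ℓ(ρ(i))` distributes as one
factor `m` per part. -/
lemma zCol_colouredParts [Fintype ι] (ρ : ι → Par) :
    zCol (Fintype.card ι) (colouredParts ρ) = zWreath ρ := by
  have hsub : (colouredParts ρ).toFinset ⊆
      Finset.univ ×ˢ Finset.univ.biUnion fun i => (ρ i).toFinset := by
    rintro ⟨i, r⟩ hx
    rw [Multiset.mem_toFinset, ← Multiset.count_pos, count_colouredParts, Multiset.count_pos] at hx
    simpa using ⟨i, hx⟩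
  rw [zCol_eq_prod _ _ _ hsub, Finset.prod_product, zWreath]
  refine Finset.prod_congr rfl fun i _ => ?_
  simp only [count_colouredParts]
  rw [← Multiset.toFinset_sum_count_eq, zPar, ← Finset.prod_pow_eq_pow_sum,
    ← Finset.prod_mul_distrib]
  symm
  have : ∀ r : ℕ+, ((ρ i).count r).factorial * (r : ℕ) ^ (ρ i).count r *
      Fintype.card ι ^ (ρ i).count r =
      ((ρ i).count r).factorial * (Fintype.card ι * (r : ℕ)) ^ (ρ i).count r := by
    intro r
    rw [mul_pow]
    ring
  simp only [this]
  refine Finset.prod_subset (Finset.subset_biUnion_of_mem (fun i => (ρ i).toFinset)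
    (Finset.mem_univ i)) fun r _ hr => ?_
  rw [Multiset.mem_toFinset] at hr
  simp [Multiset.count_eq_zero_of_notMem hr]

variable {B : Type*} [CommRing B] [Algebra ℂ B]

/-- Removing one copy of `x` divides `zCol` by multiplicity times `m` times size; the scalar on the
left absorbs all but `m`. -/
lemma smul_prod_cons (m : ℕ) [NeZero m] (u : ι × ℕ+ → B) (x : ι × ℕ+) (s : Multiset (ι × ℕ+)) :
    (((x ::ₘ s).count x * (x.2 : ℕ) : ℕ) : ℂ) • ((zCol m (x ::ₘ s) : ℂ)⁻¹ •
      ((x ::ₘ s).map u).prod) =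
    ((m : ℂ)⁻¹ • u x) * ((zCol m s : ℂ)⁻¹ • (s.map u).prod) := by
  rw [Multiset.map_cons, Multiset.prod_cons, smul_mul_smul_comm, smul_smul, zCol_cons,
    Multiset.count_cons_self]
  congr 1
  have h1 : (m : ℂ) ≠ 0 := Nat.cast_ne_zero.2 (NeZero.ne m)
  have h2 : (zCol m s : ℂ) ≠ 0 := Nat.cast_ne_zero.2 (zCol_ne_zero m s)
  have h3 : ((x.2 : ℕ) : ℂ) ≠ 0 := Nat.cast_ne_zero.2 x.2.ne_zero
  have h4 : ((s.count x : ℂ) + 1) ≠ 0 := Nat.cast_add_one_ne_zero _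
  push_cast
  field_simp

variable [Fintype ι]

/-- Sizes and multiplicities are both at most the weight, so all these multisets lie below one fixed
multiset. -/
lemma finite_weight_eq (n : ℕ) : {s : Multiset (ι × ℕ+) | weight s = n}.Finite := by
  -- The bound `n + 1` instead of `n` keeps the endpoint positive when `n = 0`.
  let T : Finset (ι × ℕ+) := Finset.univ ×ˢ Finset.Icc 1 n.succPNat
  refine (Set.finite_Iic (n • T.val)).subset ?_
  intro s hs
  have hs : weight s = n := hs
  refine Multiset.le_iff_count.2 fun x => ?_
  by_cases hx : x ∈ s
  · have hle : s.count x * (x.2 : ℕ) ≤ n := by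
      rw [← hs, weight_eq_sum]
      exact Finset.single_le_sum (f := fun x : ι × ℕ+ => s.count x * (x.2 : ℕ))
        (fun _ _ => Nat.zero_le _) (Multiset.mem_toFinset.2 hx)
    have h1 := x.2.pos
    have h2 : 0 < s.count x := Multiset.count_pos.2 hx
    have hxT : x ∈ T := by
      simp only [T, Finset.mem_product, Finset.mem_univ, true_and, Finset.mem_Icc, one_le]
      rw [← PNat.coe_le_coe, Nat.succPNat_coe]
      nlinarith
    rw [Multiset.count_nsmul, Multiset.count_eq_one_of_mem T.nodup hxT, mul_one]
    nlinarith
  · rw [Multiset.count_eq_zero_of_notMem hx]; exact Nat.zero_le _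

/-- The coloured multisets of weight `n`. -/
def ofWeight (ι : Type) [Fintype ι] (n : ℕ) : Finset (Multiset (ι × ℕ+)) :=
  (finite_weight_eq n).toFinset

lemma mem_ofWeight {n : ℕ} {s : Multiset (ι × ℕ+)} : s ∈ ofWeight ι n ↔ weight s = n := by
  simp [ofWeight]

/-- The recurrence for the coefficients of `exp (∑_x u_x / (m r_x))`. -/
lemma weight_recurrence (m : ℕ) [NeZero m] (u : ι × ℕ+ → B) (n : ℕ) :
    ((n + 1 : ℕ) : ℂ) • ∑ s ∈ ofWeight ι (n + 1), (zCol m s : ℂ)⁻¹ • (s.map u).prod =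
      ∑ k ∈ Finset.range (n + 1), ((m : ℂ)⁻¹ • ∑ i, u (i, k.succPNat)) *
        ∑ s ∈ ofWeight ι (n - k), (zCol m s : ℂ)⁻¹ • (s.map u).prod := by
  -- The weight `n + 1` is the sum of multiplicity times size over the distinct parts; the share of
  -- `x` pays for removing one copy of `x`.
  have hl : ∀ s ∈ ofWeight ι (n + 1),
      ((n + 1 : ℕ) : ℂ) • ((zCol m s : ℂ)⁻¹ • (s.map u).prod) =
      ∑ x ∈ s.toFinset, ((m : ℂ)⁻¹ • u x) *
        ((zCol m (s.erase x) : ℂ)⁻¹ • ((s.erase x).map u).prod) := by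
    intro s hs
    rw [← mem_ofWeight.1 hs, weight_eq_sum, Nat.cast_sum, Finset.sum_smul]
    refine Finset.sum_congr rfl fun x hx => ?_
    conv_lhs => rw [← Multiset.cons_erase (Multiset.mem_toFinset.1 hx)]
    exact smul_prod_cons m u x _
  have hpred : ∀ x : ι × ℕ+, (x.1, ((x.2 : ℕ) - 1).succPNat) = x := fun x =>
    Prod.ext rfl (PNat.eq (Nat.succ_pred_eq_of_pos x.2.pos))
  rw [Finset.smul_sum, Finset.sum_congr rfl hl]
  simp only [Finset.smul_sum, Finset.sum_mul, Finset.mul_sum]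
  simp only [← Finset.sum_product']
  rw [Finset.sum_sigma', Finset.sum_sigma']
  -- A multiset with a marked part `x` corresponds to the multiset without it, the colour of `x`,
  -- and `k` equal to its size minus one.
  refine Finset.sum_bij' (fun y _ => ⟨(y.2.2 : ℕ) - 1, (y.1.erase y.2, y.2.1)⟩)
    (fun y _ => ⟨(y.2.2, y.1.succPNat) ::ₘ y.2.1, (y.2.2, y.1.succPNat)⟩) ?_ ?_ ?_ ?_ ?_
  · rintro ⟨s, x⟩ hy
    simp only [Finset.mem_sigma, mem_ofWeight, Multiset.mem_toFinset] at hy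
    have hw := weight_cons x (s.erase x)
    rw [Multiset.cons_erase hy.2, hy.1] at hw
    have := x.2.pos
    simp only [Finset.mem_sigma, Finset.mem_range, Finset.mem_product, mem_ofWeight,
      Finset.mem_univ, and_true]
    omega
  · rintro ⟨k, s, i⟩ hy
    simp only [Finset.mem_sigma, Finset.mem_range, Finset.mem_product, mem_ofWeight,
      Finset.mem_univ, and_true] at hy
    simp only [Finset.mem_sigma, mem_ofWeight, Multiset.mem_toFinset, Multiset.mem_cons_self,
      and_true, weight_cons, Nat.succPNat_coe]
    omega
  · rintro ⟨s, x⟩ hy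
    simp only [Finset.mem_sigma, mem_ofWeight, Multiset.mem_toFinset] at hy
    simp only [hpred x, Multiset.cons_erase hy.2]
  · rintro ⟨k, s, i⟩ -
    simp
  · rintro ⟨s, x⟩ hy
    simp only [hpred x]

end coloured

/-! ### Expansion of the kernel in power sums -/

/-- Both operations are substitutions, so it suffices to compare them on the variables. -/
lemma expand_rename {σ τ : Type*} (e : σ ↪ τ) (n : ℕ) (hn : n ≠ 0) (f : MvPowerSeries σ ℂ) :
    MvPowerSeries.expand n hn (MvPowerSeries.rename e f) =
      MvPowerSeries.rename e (MvPowerSeries.expand n hn f) := by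
  rw [MvPowerSeries.rename_eq_subst, MvPowerSeries.rename_eq_subst,
    MvPowerSeries.expand_subst n hn (MvPowerSeries.HasSubst.X_comp e),
    MvPowerSeries.expand.eq_def (σ := σ), MvPowerSeries.substAlgHom_apply,
    MvPowerSeries.subst_comp_subst_apply
      (MvPowerSeries.HasSubst.X_pow hn) (MvPowerSeries.HasSubst.X_comp e)]
  congr 1
  funext i
  rw [MvPowerSeries.subst_pow (MvPowerSeries.HasSubst.X_comp e),
    MvPowerSeries.subst_X (MvPowerSeries.HasSubst.X_comp e)]
  simp

/-- The two variable sets are disjoint, so a monomial splits in only one way into a pure `σ`-part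
and a pure `τ`-part. -/
lemma coeff_sumElim_rename_mul {σ τ : Type*} (f : MvPowerSeries σ ℂ) (g : MvPowerSeries τ ℂ)
    (α : σ →₀ ℕ) (β : τ →₀ ℕ) :
    MvPowerSeries.coeff (Finsupp.sumElim α β)
      (MvPowerSeries.rename (Function.Embedding.inl : σ ↪ σ ⊕ τ) f *
        MvPowerSeries.rename (Function.Embedding.inr : τ ↪ σ ⊕ τ) g) =
      MvPowerSeries.coeff α f * MvPowerSeries.coeff β g := by
  have hadd : Finsupp.embDomain (Function.Embedding.inl : σ ↪ σ ⊕ τ) α +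
      Finsupp.embDomain (Function.Embedding.inr : τ ↪ σ ⊕ τ) β = Finsupp.sumElim α β := by
    rw [Finsupp.embDomain_eq_mapDomain, Finsupp.embDomain_eq_mapDomain, Finsupp.sumElim_eq_add]
    rfl
  rw [MvPowerSeries.coeff_mul, Finset.sum_eq_single (Finsupp.embDomain Function.Embedding.inl α,
    Finsupp.embDomain Function.Embedding.inr β)]
  · rw [MvPowerSeries.coeff_embDomain_rename, MvPowerSeries.coeff_embDomain_rename]
  · rintro ⟨a, b⟩ hab hne
    rw [Finset.HasAntidiagonal.mem_antidiagonal] at hab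
    dsimp only at hab ⊢
    by_cases ha : a ∈ Set.range (Finsupp.mapDomain (Function.Embedding.inl : σ ↪ σ ⊕ τ))
    · by_cases hb : b ∈ Set.range (Finsupp.mapDomain (Function.Embedding.inr : τ ↪ σ ⊕ τ))
      · obtain ⟨a, rfl⟩ := ha
        obtain ⟨b, rfl⟩ := hb
        have hab' : Finsupp.sumElim a b = Finsupp.sumElim α β := by
          rw [← hab, Finsupp.sumElim_eq_add]
          rfl
        have h1 : a = α := by
          rw [← Finsupp.comapDomain_inl_sumElim a b, hab', Finsupp.comapDomain_inl_sumElim]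
        have h2 : b = β := by
          rw [← Finsupp.comapDomain_inr_sumElim a b, hab', Finsupp.comapDomain_inr_sumElim]
        refine absurd ?_ hne
        rw [h1, h2, Finsupp.embDomain_eq_mapDomain, Finsupp.embDomain_eq_mapDomain]
      · rw [MvPowerSeries.coeff_rename_eq_zero _ g hb, mul_zero]
    · rw [MvPowerSeries.coeff_rename_eq_zero _ f ha, zero_mul]
  · intro h
    exact absurd (Finset.HasAntidiagonal.mem_antidiagonal.2 hadd) h

/-- Homogeneity of products of power sums; it makes the grading by degree match the grading by
weight. -/
lemma degree_eq_weight_of_coeff_ne_zero {σ ι : Type*} (c : σ → ι) (s : Multiset (ι × ℕ+))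
    (α : σ →₀ ℕ) (hα : MvPowerSeries.coeff α (colourPowerProd c s) ≠ 0) :
    α.degree = (s.map fun x => (x.2 : ℕ)).sum := by
  induction s using Multiset.induction_on generalizing α with
  | empty =>
    rw [colourPowerProd, Multiset.map_zero, Multiset.prod_zero, MvPowerSeries.coeff_one] at hα
    have : α = 0 := by by_contra h'; simp [h'] at hα
    subst this
    simp
  | cons x s ih =>
    rw [colourPowerProd_cons, MvPowerSeries.coeff_mul] at hα
    obtain ⟨⟨a, b⟩, hab, hne⟩ := Finset.exists_ne_zero_of_sum_ne_zero hα
    rw [Finset.HasAntidiagonal.mem_antidiagonal] at hab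
    dsimp only at hab hne
    have ha := left_ne_zero_of_mul hne
    rw [coeff_colourPowerSum] at ha
    obtain ⟨v, -, rfl⟩ : ∃ v, c v = x.1 ∧ a = Finsupp.single v (x.2 : ℕ) := by
      by_contra h'; simp [h'] at ha
    rw [← hab, map_add, Finsupp.degree_single, ih b (right_ne_zero_of_mul hne),
      Multiset.map_cons, Multiset.sum_cons]

section kernelOf
variable {ι : Type}

/-- `∏_x p_{r_x}(g_{c_x})`, where `c_x` is the colour and `r_x` the size of the coloured part `x`. -/
def expandProd {τ : Type*} (g : ι → MvPowerSeries τ ℂ) (s : Multiset (ι × ℕ+)) :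
    MvPowerSeries τ ℂ :=
  (s.map fun x => MvPowerSeries.expand (x.2 : ℕ) x.2.ne_zero (g x.1)).prod

lemma coe_inVars_p (n : ℕ+) (i : ι) :
    (inVars (p n) i : MvPowerSeries (ι × ℕ) ℂ) = colourPowerSum Prod.fst i n :=
  rename_pSeries i n

lemma expand_inVars_p_one (n : ℕ+) (i : ι) :
    MvPowerSeries.expand (n : ℕ) n.ne_zero (inVars (p 1) i : MvPowerSeries (ι × ℕ) ℂ) =
      (inVars (p n) i : MvPowerSeries (ι × ℕ) ℂ) := by
  rw [coe_inVars_p, coe_inVars_p, PNat.one_coe, expand_colourPowerSum]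

/-- The series whose part of degree `n` in the variables `x_{i,k}` is that of `F n`. -/
def gradedSum (F : ℕ → MvPowerSeries ((ι × ℕ) ⊕ ℕ) ℂ) : MvPowerSeries ((ι × ℕ) ⊕ ℕ) ℂ := fun γ =>
  MvPowerSeries.coeff γ (F (Finsupp.comapDomain Sum.inl γ Sum.inl_injective.injOn).degree)

lemma coeff_gradedSum (F : ℕ → MvPowerSeries ((ι × ℕ) ⊕ ℕ) ℂ) (α : ι × ℕ →₀ ℕ) (β : ℕ →₀ ℕ) :
    MvPowerSeries.coeff (Finsupp.sumElim α β) (gradedSum F) =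
      MvPowerSeries.coeff (Finsupp.sumElim α β) (F α.degree) := by
  have hdef : ∀ γ, MvPowerSeries.coeff γ (gradedSum F) = MvPowerSeries.coeff γ
      (F (Finsupp.comapDomain Sum.inl γ Sum.inl_injective.injOn).degree) := fun γ => rfl
  rw [hdef, Finsupp.comapDomain_inl_sumElim]

lemma coeff_coeffY (F : MvPowerSeries ((ι × ℕ) ⊕ ℕ) ℂ) (α : ι × ℕ →₀ ℕ) (β : ℕ →₀ ℕ) :
    MvPowerSeries.coeff α (coeffY β F) = MvPowerSeries.coeff (Finsupp.sumElim α β) F := rfl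

variable (g : ι → MvPowerSeries ℕ ℂ)

/-- `p_r(X_i) p_r(g_i(Y))`. -/
def kernelTerm (x : ι × ℕ+) : MvPowerSeries ((ι × ℕ) ⊕ ℕ) ℂ :=
  MvPowerSeries.rename (Function.Embedding.inl : ι × ℕ ↪ (ι × ℕ) ⊕ ℕ)
      (colourPowerSum Prod.fst x.1 x.2) *
    MvPowerSeries.rename (Function.Embedding.inr : ℕ ↪ (ι × ℕ) ⊕ ℕ)
      (MvPowerSeries.expand (x.2 : ℕ) x.2.ne_zero (g x.1))

lemma prod_kernelTerm (s : Multiset (ι × ℕ+)) : (s.map (kernelTerm g)).prod =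
    MvPowerSeries.rename (Function.Embedding.inl : ι × ℕ ↪ (ι × ℕ) ⊕ ℕ)
        (colourPowerProd Prod.fst s) *
      MvPowerSeries.rename (Function.Embedding.inr : ℕ ↪ (ι × ℕ) ⊕ ℕ) (expandProd g s) := by
  rw [colourPowerProd, expandProd, map_multiset_prod, map_multiset_prod, Multiset.map_map,
    Multiset.map_map, ← Multiset.prod_map_mul]
  rfl

variable [Fintype ι]

/-- The series `(1/m) ∑_i X_i g_i(Y)`, where `m` is the number of colours. -/
def kernelOf : MvPowerSeries ((ι × ℕ) ⊕ ℕ) ℂ :=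
  (1 / (Fintype.card ι : ℂ)) • ∑ i : ι,
    MvPowerSeries.rename (Function.Embedding.inl : ι × ℕ ↪ (ι × ℕ) ⊕ ℕ)
        (inVars (p 1) i : MvPowerSeries (ι × ℕ) ℂ) *
      MvPowerSeries.rename (Function.Embedding.inr : ℕ ↪ (ι × ℕ) ⊕ ℕ) (g i)

/-- Plethysm leaves the scalar `1/m` as it is for every `n`; this is the source of one factor `m`
per part in `Z_ρ`. -/
lemma pleth_kernelOf_p (n : ℕ+) :
    pleth (kernelOf g) (p n) = (Fintype.card ι : ℂ)⁻¹ • ∑ i, kernelTerm g (i, n) := by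
  rw [pleth_p, kernelOf, map_smul, map_sum, one_div]
  simp only [map_mul, expand_rename, coe_inVars_p, PNat.one_coe, expand_colourPowerSum, kernelTerm]

lemma ofWeight_zero : ofWeight ι 0 = {0} := by
  ext s
  rw [mem_ofWeight, Finset.mem_singleton]
  refine ⟨fun h0 => ?_, fun h0 => by simp [h0, weight]⟩
  refine Multiset.eq_zero_of_forall_notMem fun x hx => ?_
  obtain ⟨t, rfl⟩ := Multiset.exists_cons_of_mem hx
  rw [weight_cons] at h0
  have := x.2.pos
  omega

/-- Both sides have the same value at `n = 0` and obey the same recursion, by `newton_h` on the left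
and `weight_recurrence` on the right. -/
lemma pleth_kernelOf_h [Nonempty ι] (n : ℕ) : pleth (kernelOf g) (h n) =
    ∑ s ∈ ofWeight ι n, (zCol (Fintype.card ι) s : ℂ)⁻¹ • (s.map (kernelTerm g)).prod := by
  induction n using Nat.strong_induction_on with
  | _ n ih =>
    cases n with
    | zero => simp [h_zero, ofWeight_zero, zCol]
    | succ n =>
      have hn : ((n + 1 : ℕ) : ℂ) ≠ 0 := Nat.cast_ne_zero.2 n.succ_ne_zero
      refine smul_right_injective _ hn ?_
      dsimp only
      rw [weight_recurrence, ← map_smul, Nat.cast_smul_eq_nsmul, nsmul_eq_mul, newton_h, map_sum]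
      refine Finset.sum_congr rfl fun k hk => ?_
      rw [map_mul, pleth_kernelOf_p, ih (n - k) (by omega)]

lemma coeff_pleth_kernelOf_h [Nonempty ι] (n : ℕ) (α : ι × ℕ →₀ ℕ) (β : ℕ →₀ ℕ) :
    MvPowerSeries.coeff (Finsupp.sumElim α β) (pleth (kernelOf g) (h n)) =
      ∑ s ∈ ofWeight ι n, (zCol (Fintype.card ι) s : ℂ)⁻¹ *
        (MvPowerSeries.coeff α (colourPowerProd Prod.fst s) *
          MvPowerSeries.coeff β (expandProd g s)) := by
  rw [pleth_kernelOf_h, map_sum]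
  refine Finset.sum_congr rfl fun s _ => ?_
  rw [map_smul, smul_eq_mul, prod_kernelTerm, coeff_sumElim_rename_mul]

lemma coeff_pleth_kernelOf_h_of_ne [Nonempty ι] {n : ℕ} {α : ι × ℕ →₀ ℕ} (hn : n ≠ α.degree)
    (β : ℕ →₀ ℕ) :
    MvPowerSeries.coeff (Finsupp.sumElim α β) (pleth (kernelOf g) (h n)) = 0 := by
  rw [coeff_pleth_kernelOf_h]
  refine Finset.sum_eq_zero fun s hs => ?_
  by_cases h0 : MvPowerSeries.coeff α (colourPowerProd Prod.fst s) = 0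
  · rw [h0, zero_mul, mul_zero]
  · refine absurd ?_ hn
    rw [degree_eq_weight_of_coeff_ne_zero _ _ _ h0, ← mem_ofWeight.1 hs, weight]

/-- The `n`-th term is homogeneous of degree `n` in the `x_{i,k}`, so each monomial meets a single
term and the infinite sum converges. -/
lemma plethExp_kernelOf [Nonempty ι] : plethExp (kernelOf g) =
    gradedSum fun n => pleth (kernelOf g) (h n) := by
  refine HasSum.tsum_eq ?_
  rw [MvPowerSeries.WithPiTopology.hasSum_iff_hasSum_coeff]
  intro γ
  rw [← Finsupp.comapDomain_sumElim_comapDomain γ, coeff_gradedSum]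
  exact hasSum_single _ fun n hn => coeff_pleth_kernelOf_h_of_ne g hn _

lemma homogeneousComponent_coeffY_plethExp [Nonempty ι] (d : ℕ) (β : ℕ →₀ ℕ) :
    MvPowerSeries.homogeneousComponent d (coeffY β (plethExp (kernelOf g))) =
      ∑ s ∈ ofWeight ι d, ((zCol (Fintype.card ι) s : ℂ)⁻¹ *
        MvPowerSeries.coeff β (expandProd g s)) • colourPowerProd Prod.fst s := by
  ext α
  rw [MvPowerSeries.coeff_homogeneousComponent, map_sum, plethExp_kernelOf,
    coeff_coeffY, coeff_gradedSum]
  simp only [map_smul, smul_eq_mul]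
  have hsum : ∑ s ∈ ofWeight ι d, (zCol (Fintype.card ι) s : ℂ)⁻¹ *
      MvPowerSeries.coeff β (expandProd g s) *
        MvPowerSeries.coeff α (colourPowerProd Prod.fst s) =
      MvPowerSeries.coeff (Finsupp.sumElim α β) (pleth (kernelOf g) (h d)) := by
    rw [coeff_pleth_kernelOf_h]
    exact Finset.sum_congr rfl fun s _ => by ring
  rw [hsum]
  split_ifs with hd
  · rw [hd]
  · rw [coeff_pleth_kernelOf_h_of_ne g (Ne.symm hd)]

/-! ### Pairing with the kernel -/

lemma wreathBasis_apply (ρ : ι → Par) : wreathBasis ι ρ = wreathP ρ := by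
  simp [wreathBasis]

lemma wreathPairing_wreathP (ρ γ : ι → Par) :
    wreathPairing (wreathP ρ) (wreathP γ) = if ρ = γ then (zWreath ρ : ℂ) else 0 := by
  rw [← wreathBasis_apply, ← wreathBasis_apply, wreathPairing, Module.Basis.constr_basis,
    Module.Basis.constr_basis]

/-- The linear map `R → ℂ[[Y]]` with `P_ρ ↦ ∏_i p_{ρ(i)}(g_i)`. -/
def evalLinear : wreathRing ι →ₗ[ℂ] MvPowerSeries ℕ ℂ :=
  (wreathBasis ι).constr ℂ fun ρ => expandProd g (colouredParts ρ)

lemma evalLinear_wreathP (ρ : ι → Par) :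
    evalLinear g (wreathP ρ) = expandProd g (colouredParts ρ) := by
  rw [← wreathBasis_apply, evalLinear, Module.Basis.constr_basis]

lemma eq_wreathP_of_coe_eq {a : wreathRing ι} {s : Multiset (ι × ℕ+)}
    (ha : (a : MvPowerSeries (ι × ℕ) ℂ) = colourPowerProd Prod.fst s) :
    ∃ ρ, colouredParts ρ = s ∧ a = wreathP ρ := by
  obtain ⟨ρ, hρ⟩ := colouredParts_surjective s
  exact ⟨ρ, hρ, Subtype.ext (by rw [ha, coe_wreathP, hρ])⟩

lemma evalLinear_of_coe_eq {a : wreathRing ι} {s : Multiset (ι × ℕ+)}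
    (ha : (a : MvPowerSeries (ι × ℕ) ℂ) = colourPowerProd Prod.fst s) :
    evalLinear g a = expandProd g s := by
  obtain ⟨ρ, rfl, rfl⟩ := eq_wreathP_of_coe_eq ha
  exact evalLinear_wreathP g ρ

/-- The algebra homomorphism `R → ℂ[[Y]]` that replaces `X_i` by `g_i(Y)`. -/
def evalHom : wreathRing ι →ₐ[ℂ] MvPowerSeries ℕ ℂ :=
  AlgHom.ofLinearMap (evalLinear g)
    (by
      rw [evalLinear_of_coe_eq g (s := 0) (by simp [colourPowerProd])]
      simp [expandProd])
    (by
      -- Multiplicativity is checked on the basis, where multiplying power sum products means adding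
      -- coloured multisets.
      rw [LinearMap.map_mul_iff]
      refine (wreathBasis ι).ext fun ρ => (wreathBasis ι).ext fun γ => ?_
      rw [wreathBasis_apply, wreathBasis_apply]
      change evalLinear g (wreathP ρ * wreathP γ) =
        evalLinear g (wreathP ρ) * evalLinear g (wreathP γ)
      rw [evalLinear_wreathP, evalLinear_wreathP,
        evalLinear_of_coe_eq g (s := colouredParts ρ + colouredParts γ)]
      · simp [expandProd]
      · rw [MulMemClass.coe_mul, coe_wreathP, coe_wreathP]
        simp [colourPowerProd])

lemma evalHom_inVars_p (n : ℕ+) (i : ι) :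
    evalHom g (inVars (p n) i) = MvPowerSeries.expand (n : ℕ) n.ne_zero (g i) := by
  change evalLinear g _ = _
  rw [evalLinear_of_coe_eq g (s := {(i, n)})]
  · simp [expandProd]
  · rw [coe_inVars_p]
    simp [colourPowerProd]

/-- This guarantees that `seriesPairing` discards no component of the kernel. -/
lemma homogeneousComponent_mem [Nonempty ι] (d : ℕ) (β : ℕ →₀ ℕ) :
    MvPowerSeries.homogeneousComponent d (coeffY β (plethExp (kernelOf g))) ∈ wreathRing ι := by
  rw [homogeneousComponent_coeffY_plethExp]
  refine Subalgebra.sum_mem _ fun s _ => Subalgebra.smul_mem _ ?_ _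
  obtain ⟨ρ, rfl⟩ := colouredParts_surjective s
  rw [← coe_wreathP]
  exact (wreathP ρ).2

/-- By orthogonality only the term indexed by the parts of `γ` survives, and its coefficient `1 /
zCol` cancels `Z_γ`. -/
lemma wreathPairing_homogeneousComponent_wreathP [Nonempty ι] (d : ℕ) (β : ℕ →₀ ℕ) (γ : ι → Par) :
    wreathPairing ⟨_, homogeneousComponent_mem g d β⟩ (wreathP γ) =
      if d = weight (colouredParts γ) then
        MvPowerSeries.coeff β (expandProd g (colouredParts γ)) else 0 := by
  choose r hr using colouredParts_surjective (ι := ι)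
  have hrep : (⟨_, homogeneousComponent_mem g d β⟩ : wreathRing ι) =
      ∑ s ∈ ofWeight ι d, ((zCol (Fintype.card ι) s : ℂ)⁻¹ *
        MvPowerSeries.coeff β (expandProd g s)) • wreathP (r s) := by
    apply Subtype.ext
    rw [AddSubmonoidClass.coe_finsetSum]
    simp only [SetLike.val_smul, coe_wreathP, hr]
    exact homogeneousComponent_coeffY_plethExp g d β
  have hterm : ∀ s ∈ ofWeight ι d, ((zCol (Fintype.card ι) s : ℂ)⁻¹ *
      MvPowerSeries.coeff β (expandProd g s)) * (if r s = γ then (zWreath (r s) : ℂ) else 0) =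
      if s = colouredParts γ then MvPowerSeries.coeff β (expandProd g s) else 0 := by
    intro s _
    have hiff : r s = γ ↔ s = colouredParts γ :=
      ⟨fun hs => by rw [← hs, hr], fun hs => colouredParts_injective (by rw [hr, hs])⟩
    rw [if_congr hiff rfl rfl, ← zCol_colouredParts, hr]
    have hz : (zCol (Fintype.card ι) s : ℂ) ≠ 0 := Nat.cast_ne_zero.2 (zCol_ne_zero _ s)
    split_ifs
    · field_simp
    · rw [mul_zero]
  rw [hrep, map_sum, LinearMap.sum_apply]
  simp only [map_smul, LinearMap.smul_apply, smul_eq_mul, wreathPairing_wreathP]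
  rw [Finset.sum_congr rfl hterm, Finset.sum_ite_eq', if_congr mem_ofWeight rfl rfl]
  exact if_congr eq_comm rfl rfl

/-- Pairing with the kernel is the substitution of `g_i(Y)` for `X_i`. -/
lemma seriesPairing_plethExp [Nonempty ι] (f : wreathRing ι) :
    seriesPairing (plethExp (kernelOf g)) f = evalHom g f := by
  ext β
  change (∑ᶠ d : ℕ, if hR : _ ∈ wreathRing ι then _ else 0) = _
  simp only [dif_pos (homogeneousComponent_mem g _ β)]
  set L : ℕ → wreathRing ι →ₗ[ℂ] ℂ := fun d =>
    wreathPairing ⟨_, homogeneousComponent_mem g d β⟩ with hL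
  -- Finiteness of the support is carried through the induction: `finsum` is 0 on infinite support,
  -- and its additivity needs finite supports.
  suffices H : (Function.support fun d => L d f).Finite ∧
      ∑ᶠ d, L d f = MvPowerSeries.coeff β (evalHom g f) from H.2
  have hf : f ∈ Submodule.span ℂ (Set.range (wreathP : (ι → Par) → wreathRing ι)) :=
    span_wreathP trivial
  induction hf using Submodule.span_induction with
  | mem x hx =>
    obtain ⟨γ, rfl⟩ := hx
    have hs : ∀ d, L d (wreathP γ) = if d = weight (colouredParts γ) then
        MvPowerSeries.coeff β (expandProd g (colouredParts γ)) else 0 := fun d =>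
      wreathPairing_homogeneousComponent_wreathP g d β γ
    refine ⟨(Set.finite_singleton (weight (colouredParts γ))).subset fun d hd => ?_, ?_⟩
    · by_contra hne
      exact hd ((hs d).trans (if_neg hne))
    · rw [finsum_eq_single _ (weight (colouredParts γ)) fun d hd => (hs d).trans (if_neg hd), hs,
        if_pos rfl]
      exact congrArg _ (evalLinear_wreathP g γ).symm
  | zero => simp
  | add x y _ _ hx hy =>
    simp only [map_add]
    exact ⟨(hx.1.union hy.1).subset (Function.support_add _ _),
      by rw [finsum_add_distrib hx.1 hy.1, hx.2, hy.2]⟩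
  | smul a x _ hx =>
    simp only [map_smul]
    exact ⟨hx.1.subset (Function.support_const_smul_subset a _),
      by rw [← smul_finsum' a hx.1, hx.2]⟩

/-! ### Complex conjugation of the coefficients -/

lemma map_conj_colourPowerSum {σ κ : Type*} (c : σ → κ) (i : κ) (n : ℕ) :
    MvPowerSeries.map (starRingEnd ℂ) (colourPowerSum c i n) = colourPowerSum c i n := by
  ext α
  rw [MvPowerSeries.coeff_map, coeff_colourPowerSum]
  split_ifs <;> simp

lemma map_conj_colourPowerProd {σ κ : Type*} (c : σ → κ) (s : Multiset (κ × ℕ+)) :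
    MvPowerSeries.map (starRingEnd ℂ) (colourPowerProd c s) = colourPowerProd c s := by
  rw [colourPowerProd, map_multiset_prod, Multiset.map_map]
  simp only [Function.comp_def, map_conj_colourPowerSum]

lemma map_conj_smul {σ : Type*} (a : ℂ) (f : MvPowerSeries σ ℂ) :
    MvPowerSeries.map (starRingEnd ℂ) (a • f) =
      (starRingEnd ℂ) a • MvPowerSeries.map (starRingEnd ℂ) f := by
  ext α
  simp

/-- `wreathConj` conjugates the coefficients in the variables `x_{i,k}`. -/
lemma coe_wreathConj (f : wreathRing ι) : (wreathConj f : MvPowerSeries (ι × ℕ) ℂ) =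
    MvPowerSeries.map (starRingEnd ℂ) (f : MvPowerSeries (ι × ℕ) ℂ) := by
  -- The `P_ρ` have real coefficients, so conjugating coordinates in this basis is conjugating
  -- monomial coefficients; multiplicativity is then evident.
  conv_rhs => rw [← (wreathBasis ι).linearCombination_repr f, Finsupp.linearCombination_apply]
  rw [wreathConj, Finsupp.sum, Finsupp.sum, AddSubmonoidClass.coe_finsetSum,
    AddSubmonoidClass.coe_finsetSum, map_sum]
  refine Finset.sum_congr rfl fun ρ _ => ?_
  rw [SetLike.val_smul, SetLike.val_smul, map_conj_smul, wreathBasis_apply, coe_wreathP,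
    map_conj_colourPowerProd]

/-- `wreathConj` as a ring homomorphism. -/
def wreathConjHom (ι : Type) [Fintype ι] : wreathRing ι →+* wreathRing ι where
  toFun := wreathConj
  map_one' := Subtype.ext (by rw [coe_wreathConj]; simp)
  map_mul' f g := Subtype.ext (by
    rw [coe_wreathConj, MulMemClass.coe_mul, map_mul, MulMemClass.coe_mul, coe_wreathConj,
      coe_wreathConj])
  map_zero' := Subtype.ext (by rw [coe_wreathConj]; simp)
  map_add' f g := Subtype.ext (by
    rw [coe_wreathConj, AddMemClass.coe_add, map_add, AddMemClass.coe_add, coe_wreathConj,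
      coe_wreathConj])

lemma coe_wreathConjHom (f : wreathRing ι) : (wreathConjHom ι f : MvPowerSeries (ι × ℕ) ℂ) =
    MvPowerSeries.map (starRingEnd ℂ) (f : MvPowerSeries (ι × ℕ) ℂ) := coe_wreathConj f

lemma wreathConjHom_smul (a : ℂ) (f : wreathRing ι) :
    wreathConjHom ι (a • f) = (starRingEnd ℂ) a • wreathConjHom ι f := by
  apply Subtype.ext
  rw [SetLike.val_smul, coe_wreathConjHom, coe_wreathConjHom, SetLike.val_smul, map_conj_smul]

lemma wreathConjHom_inVars_p (n : ℕ+) (i : ι) :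
    wreathConjHom ι (inVars (p n) i) = inVars (p n) i := by
  apply Subtype.ext
  rw [coe_wreathConjHom, coe_inVars_p, map_conj_colourPowerSum]

end kernelOf

/-! ### Roots of unity -/

section main
variable (m : ℕ) [NeZero m]

lemma card_Mu : Fintype.card (Mu m) = m := by
  rw [Fintype.card_eq_nat_card, Complex.card_rootsOfUnity]

lemma conj_muVal (ζ : Mu m) : (starRingEnd ℂ) (muVal ζ) = muVal ζ⁻¹ := by
  have := Complex.conj_rootsOfUnity ζ.2
  simpa [muVal] using this

lemma zetaM_pow_eq_iff (a b : ℕ) : zetaM m ^ a = zetaM m ^ b ↔ a % m = b % m := by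
  have h1 : IsPrimitiveRoot (zetaM m) m := by
    rw [← IsPrimitiveRoot.coe_submonoidClass_iff, ← IsPrimitiveRoot.coe_units_iff]
    exact Complex.isPrimitiveRoot_exp m (NeZero.ne m)
  rw [pow_inj_mod, ← h1.eq_orderOf]

/-- Orthogonality of the characters of `μ_m`. -/
lemma sum_conj_muVal_pow_mul (j d : ℕ) :
    (1 / (m : ℂ)) * ∑ ζ : Mu m, (starRingEnd ℂ) (muVal ζ ^ j) * muVal ζ ^ d =
      if d % m = j % m then 1 else 0 := by
  -- The summand is the character `ζ ↦ ζ^{d-j}`, whose sum vanishes unless it is trivial.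
  let χ : Mu m →* ℂ :=
    { toFun := fun ζ => muVal (ζ⁻¹ ^ j * ζ ^ d)
      map_one' := by simp [muVal]
      map_mul' := fun a b => by
        simp only [muVal, mul_inv, mul_pow]
        push_cast
        ring }
  have hχ : ∀ ζ : Mu m, (starRingEnd ℂ) (muVal ζ ^ j) * muVal ζ ^ d = χ ζ := by
    intro ζ
    rw [map_pow, conj_muVal]
    simp [χ, muVal]
  have hm : (m : ℂ) ≠ 0 := Nat.cast_ne_zero.2 (NeZero.ne m)
  simp only [hχ]
  split_ifs with hd
  · have h1 : ∀ ζ : Mu m, χ ζ = 1 := by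
      intro ζ
      have hζ : ζ ^ m = 1 := by
        apply Subtype.ext
        exact ζ.2
      have : ζ ^ d = ζ ^ j := by
        rw [pow_eq_pow_mod d hζ, pow_eq_pow_mod j hζ, hd]
      change muVal (ζ⁻¹ ^ j * ζ ^ d) = 1
      rw [this, inv_pow, inv_mul_cancel]
      simp [muVal]
    simp only [h1, Finset.sum_const, Finset.card_univ, card_Mu, nsmul_eq_mul, mul_one]
    field_simp
  · rw [sum_hom_units_eq_zero χ, mul_zero]
    intro h1
    apply hd
    rw [← zetaM_pow_eq_iff]
    -- Triviality is tested on the generator `ζ_m`, which has order exactly `m`.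
    have h2 := DFunLike.congr_fun h1 (zetaM m)
    have h3 : (zetaM m)⁻¹ ^ j * zetaM m ^ d = 1 := by
      apply Subtype.ext
      apply Units.ext
      exact h2
    rw [inv_pow, inv_mul_eq_one] at h3
    exact h3.symm

/-- `∑_k h_{km+j}(Y) = (1/m) ∑_ζ ζ^{-j} Ω(Y; ζ)`. -/
lemma sum_conj_smul_OmegaAt (j : ℕ) :
    (1 / (m : ℂ)) • ∑ ζ : Mu m, (starRingEnd ℂ) (muVal ζ ^ j) • OmegaAt (muVal ζ) =
      hProgression m (j % m) := by
  ext α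
  rw [coeff_hProgression m _ (Nat.mod_lt _ (NeZero.pos m)), ← sum_conj_muVal_pow_mul]
  simp [coeff_OmegaAt]

/-! ### Specialisation to `g_ζ = Ω(Y;ζ)` and assembly -/

lemma kernelAlphabet_eq_kernelOf :
    kernelAlphabet m = kernelOf fun ζ : Mu m => OmegaAt (muVal ζ) := by
  rw [kernelAlphabet, kernelOf, card_Mu]

/-- Plethystic substitution of `φ_j(𝔛)`, with values in `R`. -/
def plethPhi (j : ℕ) : Lam →ₐ[ℂ] wreathRing (Mu m) :=
  (pleth (phi m j)).codRestrict _ fun f => pleth_mem _ _ (expand_phi_mem m j) f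

/-- The coefficient stays `ζ^j`, not `ζ^{jn}`, so the same orthogonality relation serves for every
`n`. -/
lemma plethPhi_p (j : ℕ) (n : ℕ+) : plethPhi m j (p n) =
    (1 / (m : ℂ)) • ∑ ζ : Mu m, muVal ζ ^ j • inVars (p n) ζ := by
  apply Subtype.ext
  change pleth (phi m j) (p n) = _
  rw [pleth_p, phi, map_smul, map_sum, SetLike.val_smul, AddSubmonoidClass.coe_finsetSum]
  simp only [map_smul, expand_inVars_p_one, SetLike.val_smul]

/-- Both sides are ring homomorphisms in the symmetric function, so power sums suffice. There `p_n`
goes to `(1/m) ∑ ζ^{-j} p_n(Ω(Y;ζ))`, which is `p_n` of the averaged series because `A ↦ p_n(A)` is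
linear. -/
lemma evalHom_conj_plethPhi_schur (j : ℕ) (lam : Par) :
    evalHom (fun ζ : Mu m => OmegaAt (muVal ζ))
      (wreathConjHom (Mu m) (plethPhi m j (schur lam))) =
      pleth (hProgression m (j % m)) (schur lam) := by
  refine ringHom_schur_eq (φ := ((evalHom fun ζ : Mu m => OmegaAt (muVal ζ)).toRingHom.comp
    (wreathConjHom (Mu m))).comp (plethPhi m j).toRingHom)
    (ψ := (pleth (hProgression m (j % m))).toRingHom) (fun n => ?_) lam
  change evalHom (fun ζ : Mu m => OmegaAt (muVal ζ))
    (wreathConjHom (Mu m) (plethPhi m j (p n))) = pleth (hProgression m (j % m)) (p n)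
  rw [plethPhi_p, wreathConjHom_smul, map_sum]
  simp only [wreathConjHom_smul, wreathConjHom_inVars_p]
  rw [map_smul, map_sum, pleth_p, ← sum_conj_smul_OmegaAt, map_smul, map_sum]
  simp only [map_smul, evalHom_inVars_p]
  simp

/-- The index `m` wraps around to 0; this reconciles the range `1 ≤ j ≤ m` in `S_ρ` with `0 ≤ j ≤ m
- 1` in the result. -/
lemma prod_Icc_mod {M : Type*} [CommMonoid M] (F : ℕ → M) :
    ∏ j ∈ Finset.Icc 1 m, F (j % m) = ∏ j ∈ Finset.range m, F j := by
  obtain ⟨n, rfl⟩ := Nat.exists_eq_succ_of_ne_zero (NeZero.ne m)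
  rw [Finset.range_eq_Ico, ← Finset.Ico_add_one_right_eq_Icc,
    Finset.prod_Ico_succ_top (by omega), Nat.mod_self,
    Finset.prod_eq_prod_Ico_succ_bot n.succ_pos F, mul_comm]
  congr 1
  refine Finset.prod_congr rfl fun j hj => ?_
  rw [Nat.mod_eq_of_lt (Finset.mem_Ico.1 hj).2]

end main

end

end WreathSym

theorem mainTheorem4 (m : ℕ) [NeZero m] (ρ : WreathSym.Mu m → WreathSym.Par) :
    WreathSym.G m ρ = ∏ j ∈ Finset.range m,
      WreathSym.pleth (WreathSym.hProgression m j)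
        (WreathSym.schur (ρ (WreathSym.zetaM m ^ j))) := by
  rw [WreathSym.G, WreathSym.kernelAlphabet_eq_kernelOf, WreathSym.seriesPairing_plethExp]
  change WreathSym.evalHom _ (WreathSym.wreathConjHom _ (∏ j ∈ Finset.Icc 1 m,
    WreathSym.plethPhi m j (WreathSym.schur (ρ (WreathSym.zetaM m ^ j))))) = _
  rw [map_prod, map_prod, ← WreathSym.prod_Icc_mod]
  refine Finset.prod_congr rfl fun j _ => ?_
  -- The partition attached to `j` depends only on `ζ_m^j`, hence only on `j % m`.
  rw [WreathSym.evalHom_conj_plethPhi_schur,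
    (WreathSym.zetaM_pow_eq_iff m j (j % m)).2 (Nat.mod_mod _ _).symm]
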